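/- Let $d$ and $n$ be positive integers and let $t>0$. Let $e^{t\Delta/2}$ denote the heat operator on $L^2(\mathbb{R}^d)$ (complex-valued functions, Lebesgue measure), given by $$(e^{t\Delta/2}f)(x)=\int_{\mathbb{R}^d}(2\pi t)^{-d/2}e^{-|x-x'|^2/2t}f(x')\,dx',\qquad x\in\mathbb{R}^d,$$ and let $H^n(\mathbb{R}^d)$ be the Sobolev space of those $f\in L^2(\mathbb{R}^d)$ all of whose distributional partial derivatives of order at most $n$ lie in $L^2(\mathbb{R}^d)$. An analytic continuation of a function $F:\mathbb{R}^d\to\mathbb{C}$ to $\mathbb{C}^d$ is a holomorphic function on $\mathbb{C}^d$ whose restriction to $\mathbb{R}^d$ is $F$; if one exists it is unique and is again denoted by $F$. A function $F:\mathbb{R}^d\to\mathbb{C}$ is of the form $F=e^{t\Delta/2}f$ with $f\in H^n(\mathbb{R}^d)$ if and only if $F$ has an analytic continuation to $\mathbb{C}^d$ satisfying $$\int_{\mathbb{R}^d}\int_{\mathbb{R}^d}|F(x+iy)|^2\,e^{-|y|^2/t}\,\bigl(1+|y|^{2n}\bigr)\,dy\,dx<\infty .$$ Moreover, if $F$ is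 such a function, then there is a constant $C$ (depending on $F$) such that $$|F(x+iy)|\le C\,\frac{e^{|y|^2/2t}}{1+|y|^n}\qquad\text{for all }x,y\in\mathbb{R}^d .$$ -/

import Mathlib

open MeasureTheory
open scoped SchwartzMap LineDeriv

noncomputable section

namespace HeatImage

/-- `ℝ^d` with its Euclidean norm and Lebesgue measure. -/
abbrev RSpace (d : ℕ) : Type := EuclideanSpace ℝ (Fin d)

/-- `ℂ^d`. -/
abbrev CSpace (d : ℕ) : Type := EuclideanSpace ℂ (Fin d)

/-- The Hilbert space `L²(ℝ^d, dx)` of complex-valued functions. -/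
abbrev L2Space (d : ℕ) : Type := Lp ℂ 2 (volume : Measure (RSpace d))

/-- The point `x + i y` of `ℂ^d`, for `x, y ∈ ℝ^d`. -/
def complexPoint {d : ℕ} (x y : RSpace d) : CSpace d :=
  WithLp.toLp 2 fun j => (x j : ℂ) + Complex.I * (y j : ℂ)

/-- The heat kernel `ρ_t(x) = (2πt)^{-d/2} e^{-|x|²/(2t)}` on `ℝ^d`. -/
def heatKernel {d : ℕ} (t : ℝ) (x : RSpace d) : ℝ :=
  (2 * Real.pi * t) ^ (-(d : ℝ) / 2) * Real.exp (-‖x‖ ^ 2 / (2 * t))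

/-- The time-`t` heat operator `e^{tΔ/2}` on `L²(ℝ^d)`: convolution with the heat kernel.
(The integral converges absolutely for every `x`, so this is an honest function on `ℝ^d`.) -/
def heatOperator {d : ℕ} (t : ℝ) (f : L2Space d) (x : RSpace d) : ℂ :=
  ∫ x' : RSpace d, (heatKernel t (x - x') : ℂ) * f x'

/-- `f ∈ H^n(ℝ^d)`: every distributional partial derivative
`∂_{j 0} ∂_{j 1} ⋯ ∂_{j (k - 1)} f` of order `k ≤ n` is (represented by) an element of
`L²(ℝ^d)`. The derivatives are those of the tempered distribution defined by `f`. -/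
def MemSobolev {d : ℕ} (n : ℕ) (f : L2Space d) : Prop :=
  ∀ k ≤ n, ∀ j : Fin k → Fin d, ∃ g : L2Space d,
    ∂^{fun i => (EuclideanSpace.single (j i) (1 : ℝ) : RSpace d)} (f : 𝓢'(RSpace d, ℂ)) =
      (g : 𝓢'(RSpace d, ℂ))

/-- `F` is of the form `e^{tΔ/2} f` with `f ∈ H^n(ℝ^d)`. -/
def IsHeatImageOfSobolev {d : ℕ} (t : ℝ) (n : ℕ) (F : RSpace d → ℂ) : Prop :=
  ∃ f : L2Space d, MemSobolev n f ∧ F = heatOperator t f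

/-- `Φ` is an analytic continuation of `F` from `ℝ^d` to `ℂ^d`: it is holomorphic on all of `ℂ^d`
and agrees with `F` at the real points. -/
def IsAnalyticContinuation {d : ℕ} (F : RSpace d → ℂ) (Φ : CSpace d → ℂ) : Prop :=
  Differentiable ℂ Φ ∧ ∀ x : RSpace d, Φ (complexPoint x 0) = F x

/-- `∫_{ℂ^d} |Φ(x + iy)|² e^{-|y|²/t} (1 + |y|^{2n}) dy dx < ∞`. -/
def WeightedSquareIntegrable {d : ℕ} (t : ℝ) (n : ℕ) (Φ : CSpace d → ℂ) : Prop :=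
  Integrable
    (fun p : RSpace d × RSpace d =>
      ‖Φ (complexPoint p.1 p.2)‖ ^ 2 * Real.exp (-‖p.2‖ ^ 2 / t) * (1 + ‖p.2‖ ^ (2 * n)))
    (volume : Measure (RSpace d × RSpace d))

end HeatImage

end

/-!
The Fourier transform `G` of `f` turns `e^{tΔ/2} f` into
`Φ(z) = ∫ e^{-2π²t|ξ|²} e^{2πi z·ξ} G(ξ) dξ`, which makes sense for all `z ∈ ℂ^d` and is entire
(`heatTransform`). The slice `x ↦ Φ(x + iy)` is the inverse Fourier transform of
`e^{-2π²t|ξ|² - 2π y·ξ} G(ξ)` (`sliceDensity`), so by Plancherel's formula on each slice and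
Tonelli's theorem, after completing the square,
`∫∫ |Φ(x + iy)|² e^{-|y|²/t} (1 + |y|^{2n}) dy dx = ∫ |G(ξ)|² J(ξ) dξ` with
`J(ξ) = ∫ e^{-|y + 2πtξ|²/t} (1 + |y|^{2n}) dy`. The Gaussian concentrates near `y = -2πtξ`, and
Peetre's inequality shows that `J(ξ)` is comparable to `1 + |ξ|^{2n}`
(`lintegral_imWeight_lt_top_iff`). Finiteness of the weighted norm is thus the Sobolev condition on
the Fourier side (`memSobolev_iff_lintegral`). The pointwise bound comes from the same completed
square (`exists_norm_heatTransform_le`).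

For the converse one has to recover `G` from an entire `Φ` of finite weighted norm
(`exists_eq_heatTransform`). The sub-mean value inequality bounds `Φ` uniformly on sets of bounded
imaginary part (`WeightedSquareIntegrable.norm_sq_le`). After multiplication by the holomorphic
Gaussian `e^{-ε z·z}` the contour of the Fourier integral can therefore be shifted
(`integral_complexPoint_eq`), and letting `ε → 0` in `L²` shows that `e^{2π y·ξ}` times the Fourier
transform of the slice at `y` is the same function for almost every `y`. That function,
multiplied by `e^{2π²t|ξ|²}`, is `G`.
-/

namespace HeatImage

open Complex Filter Set Topology FourierTransform
open scoped ENNReal RealInnerProductSpace ContDiff ComplexConjugate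

variable {d : ℕ}

/-! ### Real and imaginary parts in `ℂ^d` -/

@[simp]
lemma complexPoint_apply (x y : RSpace d) (j : Fin d) :
    complexPoint x y j = (x j : ℂ) + I * (y j : ℂ) := rfl

lemma complexPoint_add (x y x' y' : RSpace d) :
    complexPoint (x + x') (y + y') = complexPoint x y + complexPoint x' y' := by
  ext j
  simp
  ring

lemma smul_complexPoint (w : ℂ) (x y : RSpace d) :
    w • complexPoint x y =
      complexPoint (w.re • x - w.im • y) (w.re • y + w.im • x) := by
  ext j
  simp only [PiLp.smul_apply, complexPoint_apply, smul_eq_mul, PiLp.sub_apply, PiLp.add_apply,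
    ofReal_sub, ofReal_add, ofReal_mul]
  conv_lhs => rw [← re_add_im w]
  linear_combination (w.im : ℂ) * y j * I_mul_I

lemma exists_eq_complexPoint (z : CSpace d) : ∃ x y : RSpace d, z = complexPoint x y :=
  ⟨WithLp.toLp 2 fun j => (z j).re, WithLp.toLp 2 fun j => (z j).im, by
    ext j
    simp [mul_comm I, re_add_im]⟩

lemma continuous_complexPoint :
    Continuous fun p : RSpace d × RSpace d => complexPoint p.1 p.2 := by
  unfold complexPoint
  fun_prop

/-- Entire functions on `ℂ^d` that agree on a translate `ℝ^d + i y₀` of the real points are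
equal. -/
theorem eq_of_eqOn_real_translate {Φ Ψ : CSpace d → ℂ} (hΦ : Differentiable ℂ Φ)
    (hΨ : Differentiable ℂ Ψ) (y₀ : RSpace d)
    (h : ∀ x, Φ (complexPoint x y₀) = Ψ (complexPoint x y₀)) : Φ = Ψ := by
  funext z
  obtain ⟨x, y, rfl⟩ := exists_eq_complexPoint z
  -- Restrict to the complex line through `x + i y₀` in the direction `y - y₀`.
  have hline : Differentiable ℂ
      fun w : ℂ => complexPoint x y₀ + w • complexPoint (y - y₀) 0 := by fun_prop
  have hf : AnalyticOnNhd ℂ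
      (fun w : ℂ => Φ (complexPoint x y₀ + w • complexPoint (y - y₀) 0)) univ :=
    (hΦ.comp hline).differentiableOn.analyticOnNhd isOpen_univ
  have hg : AnalyticOnNhd ℂ
      (fun w : ℂ => Ψ (complexPoint x y₀ + w • complexPoint (y - y₀) 0)) univ :=
    (hΨ.comp hline).differentiableOn.analyticOnNhd isOpen_univ
  have hreal : ∀ s : ℝ, Φ (complexPoint x y₀ + (s : ℂ) • complexPoint (y - y₀) 0) =
      Ψ (complexPoint x y₀ + (s : ℂ) • complexPoint (y - y₀) 0) := by
    intro s
    rw [smul_complexPoint, ← complexPoint_add]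
    simpa using h _
  have hfreq : ∃ᶠ w in 𝓝[≠] (0 : ℂ),
      Φ (complexPoint x y₀ + w • complexPoint (y - y₀) 0) =
        Ψ (complexPoint x y₀ + w • complexPoint (y - y₀) 0) := by
    have hlim : Tendsto (fun s : ℝ => (s : ℂ)) (𝓝[≠] (0 : ℝ)) (𝓝[≠] (0 : ℂ)) := by
      refine tendsto_nhdsWithin_iff.2 ⟨?_, ?_⟩
      · exact (continuous_ofReal.tendsto' 0 0 (by simp)).mono_left nhdsWithin_le_nhds
      · filter_upwards [self_mem_nhdsWithin] with s hs
        simpa using hs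
    exact hlim.frequently (Eventually.frequently (Eventually.of_forall hreal))
  have key := congrFun (hf.eq_of_frequently_eq hg hfreq) I
  have hpt : complexPoint x y₀ + I • complexPoint (y - y₀) 0 = complexPoint x y := by
    rw [smul_complexPoint, ← complexPoint_add]
    simp
  simpa only [hpt] using key

/-! ### The sub-mean value inequality -/

/-- Multiplication by `e^{iθ}` on `ℂ^d = ℝ^d × ℝ^d`, as a linear isometry for the Euclidean norm
of the product. -/
noncomputable def rotation (θ : ℝ) :
    WithLp 2 (RSpace d × RSpace d) ≃ₗᵢ[ℝ] WithLp 2 (RSpace d × RSpace d) :=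
  LinearIsometry.toLinearIsometryEquiv
    { toFun := fun p => WithLp.toLp 2
        (Real.cos θ • p.fst - Real.sin θ • p.snd, Real.cos θ • p.snd + Real.sin θ • p.fst)
      map_add' := fun p q => by
        apply WithLp.ofLp_injective
        ext1
        · simp; module
        · simp; module
      map_smul' := fun c p => by
        apply WithLp.ofLp_injective
        ext1
        · simp; module
        · simp; module
      norm_map' := fun p => by
        rw [← sq_eq_sq₀ (norm_nonneg _) (norm_nonneg _), WithLp.prod_norm_sq_eq_of_L2,
          WithLp.prod_norm_sq_eq_of_L2]
        change ‖Real.cos θ • p.fst - Real.sin θ • p.snd‖ ^ 2 +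
          ‖Real.cos θ • p.snd + Real.sin θ • p.fst‖ ^ 2 = _
        rw [norm_sub_sq_real, norm_add_sq_real]
        simp only [norm_smul, mul_pow, Real.norm_eq_abs, sq_abs, real_inner_smul_left,
          real_inner_smul_right, real_inner_comm p.fst p.snd]
        linear_combination (‖p.fst‖ ^ 2 + ‖p.snd‖ ^ 2) * Real.sin_sq_add_cos_sq θ }
    rfl

lemma lintegral_rotation (θ : ℝ) (g : RSpace d × RSpace d → ℝ≥0∞) (hg : Measurable g) :
    ∫⁻ p : RSpace d × RSpace d, g
        (Real.cos θ • p.1 - Real.sin θ • p.2, Real.cos θ • p.2 + Real.sin θ • p.1) =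
      ∫⁻ p, g p := by
  have h1 : MeasurePreserving (fun p : RSpace d × RSpace d =>
      (WithLp.ofLp (rotation θ (WithLp.toLp 2 p)))) :=
    (WithLp.volume_preserving_ofLp _ _).comp
      ((rotation (d := d) θ).measurePreserving.comp (WithLp.volume_preserving_toLp _ _))
  exact h1.lintegral_comp hg

/-- The Euclidean unit ball of `ℂ^d`, in terms of real and imaginary parts. -/
def unitBall (d : ℕ) : Set (RSpace d × RSpace d) := {p | ‖p.1‖ ^ 2 + ‖p.2‖ ^ 2 ≤ 1}

lemma measurableSet_unitBall : MeasurableSet (unitBall d) :=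
  (isClosed_le (by fun_prop) (by fun_prop)).measurableSet

lemma volume_unitBall_ne_top : volume (unitBall d) ≠ ⊤ := by
  refine ne_top_of_le_ne_top
    (measure_closedBall_lt_top (x := (0 : RSpace d × RSpace d)) (r := 1)).ne (measure_mono ?_)
  rintro ⟨a, b⟩ h
  simp only [unitBall, mem_ofPred_eq] at h
  rw [mem_closedBall_zero_iff, Prod.norm_def]
  exact max_le (by nlinarith [norm_nonneg a, norm_nonneg b])
    (by nlinarith [norm_nonneg a, norm_nonneg b])

lemma volume_unitBall_ne_zero : volume (unitBall d) ≠ 0 := by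
  refine ((Metric.measure_ball_pos volume (0 : RSpace d × RSpace d)
    (r := 1 / 2) (by norm_num)).trans_le (measure_mono ?_)).ne'
  rintro ⟨a, b⟩ h
  rw [mem_ball_zero_iff, Prod.norm_def, max_lt_iff] at h
  simp only [unitBall, mem_ofPred_eq]
  nlinarith [norm_nonneg a, norm_nonneg b, h.1, h.2]

/-- The mean value property on a complex line: `|Φ(z)|²` is at most the average of `|Φ|²` over the
circle `z + e^{iθ} u`. -/
lemma enorm_sq_le_lintegral_circle {Φ : CSpace d → ℂ} (hΦ : Differentiable ℂ Φ) (z u : CSpace d) :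
    ENNReal.ofReal (2 * Real.pi) * ‖Φ z‖ₑ ^ 2 ≤
      ∫⁻ θ in Ioc 0 (2 * Real.pi), ‖Φ (z + exp (θ * I) • u)‖ₑ ^ 2 := by
  have hd : Differentiable ℂ fun w : ℂ => Φ (z + w • u) ^ 2 := by fun_prop
  have hm := (hd.diffContOnCl (s := Metric.ball 0 |1|)).circleAverage
  rw [Real.circleAverage_def] at hm
  have h2π : (0 : ℝ) < 2 * Real.pi := by positivity
  rw [inv_smul_eq_iff₀ h2π.ne', intervalIntegral.integral_of_le h2π.le] at hm
  have hle := enorm_integral_le_lintegral_enorm (μ := volume.restrict (Ioc 0 (2 * Real.pi)))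
    (fun θ => Φ (z + circleMap 0 1 θ • u) ^ 2)
  rw [hm] at hle
  rw [enorm_smul, Real.enorm_eq_ofReal h2π.le] at hle
  simpa only [circleMap, enorm_pow, zero_smul, add_zero, ofReal_one, one_mul, zero_add] using hle

/-- The sub-mean value inequality for `|Φ|²` on Euclidean unit balls. It follows from the mean
value property on complex lines by averaging over the directions, since multiplication by `e^{iθ}`
preserves the ball and its volume. -/
theorem enorm_sq_mul_volume_le {Φ : CSpace d → ℂ} (hΦ : Differentiable ℂ Φ) (x y : RSpace d) :
    volume (unitBall d) * ‖Φ (complexPoint x y)‖ₑ ^ 2 ≤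
      ∫⁻ p in unitBall d, ‖Φ (complexPoint (x + p.1) (y + p.2))‖ₑ ^ 2 := by
  have h2π : (0 : ℝ) < 2 * Real.pi := by positivity
  set c := ENNReal.ofReal (2 * Real.pi)
  have hc0 : c ≠ 0 := by simpa [c] using Real.pi_pos
  have hct : c ≠ ⊤ := ENNReal.ofReal_ne_top
  refine (ENNReal.mul_le_mul_iff_right hc0 hct).1 ?_
  have hcont := continuous_complexPoint (d := d)
  have hΦc := hΦ.continuous
  have hmeas : Measurable fun p : RSpace d × RSpace d =>
      ‖Φ (complexPoint (x + p.1) (y + p.2))‖ₑ ^ 2 := by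
    have : Continuous fun p : RSpace d × RSpace d => Φ (complexPoint (x + p.1) (y + p.2)) :=
      hΦc.comp (hcont.comp (by fun_prop : Continuous fun p : RSpace d × RSpace d =>
        (x + p.1, y + p.2)))
    exact this.measurable.enorm.pow_const 2
  calc c * (volume (unitBall d) * ‖Φ (complexPoint x y)‖ₑ ^ 2)
      = ∫⁻ _ in unitBall d, c * ‖Φ (complexPoint x y)‖ₑ ^ 2 := by
        rw [setLIntegral_const]; ring
    _ ≤ ∫⁻ p in unitBall d, ∫⁻ θ in Ioc 0 (2 * Real.pi),
          ‖Φ (complexPoint x y + exp (θ * I) • complexPoint p.1 p.2)‖ₑ ^ 2 :=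
        lintegral_mono fun p => enorm_sq_le_lintegral_circle hΦ _ _
    _ = ∫⁻ θ in Ioc 0 (2 * Real.pi), ∫⁻ p in unitBall d,
          ‖Φ (complexPoint x y + exp (θ * I) • complexPoint p.1 p.2)‖ₑ ^ 2 := by
        refine lintegral_lintegral_swap (Measurable.aemeasurable ?_)
        have : Continuous fun q : (RSpace d × RSpace d) × ℝ =>
            Φ (complexPoint x y + exp (q.2 * I) • complexPoint q.1.1 q.1.2) :=
          hΦc.comp (continuous_const.add ((by fun_prop :
            Continuous fun q : (RSpace d × RSpace d) × ℝ => exp (q.2 * I)).smul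
              (hcont.comp continuous_fst)))
        exact this.measurable.enorm.pow_const 2
    _ = ∫⁻ _ in Ioc 0 (2 * Real.pi), ∫⁻ p in unitBall d,
          ‖Φ (complexPoint (x + p.1) (y + p.2))‖ₑ ^ 2 := by
        refine lintegral_congr fun θ => ?_
        rw [← lintegral_indicator measurableSet_unitBall,
          ← lintegral_indicator measurableSet_unitBall,
          ← lintegral_rotation θ _ (hmeas.indicator measurableSet_unitBall)]
        refine lintegral_congr fun p => ?_
        have hmem : (Real.cos θ • p.1 - Real.sin θ • p.2, Real.cos θ • p.2 + Real.sin θ • p.1) ∈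
            unitBall d ↔ p ∈ unitBall d := by
          have := (rotation θ).norm_map (WithLp.toLp 2 p)
          rw [← sq_eq_sq₀ (norm_nonneg _) (norm_nonneg _), WithLp.prod_norm_sq_eq_of_L2,
            WithLp.prod_norm_sq_eq_of_L2] at this
          exact iff_of_eq (congrArg (· ≤ 1) this)
        by_cases hp : p ∈ unitBall d
        · rw [indicator_of_mem hp, indicator_of_mem (hmem.2 hp), smul_complexPoint,
            ← complexPoint_add, exp_ofReal_mul_I_re, exp_ofReal_mul_I_im]
        · rw [indicator_of_notMem hp, indicator_of_notMem (mt hmem.1 hp)]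
    _ = c * ∫⁻ p in unitBall d, ‖Φ (complexPoint (x + p.1) (y + p.2))‖ₑ ^ 2 := by
        rw [setLIntegral_const, Real.volume_Ioc, sub_zero, mul_comm]

/-- Weighted square integrability of an entire function bounds it pointwise, uniformly on each
set where the imaginary part is bounded. -/
theorem WeightedSquareIntegrable.norm_sq_le {t : ℝ} (ht : 0 < t) {n : ℕ} {Φ : CSpace d → ℂ}
    (hΦ : Differentiable ℂ Φ) (hint : WeightedSquareIntegrable t n Φ) :
    ∃ C : ℝ, 0 ≤ C ∧ ∀ x y : RSpace d,
      ‖Φ (complexPoint x y)‖ ^ 2 ≤ C * Real.exp ((‖y‖ + 1) ^ 2 / t) := by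
  set W : RSpace d × RSpace d → ℝ := fun p =>
    ‖Φ (complexPoint p.1 p.2)‖ ^ 2 * Real.exp (-‖p.2‖ ^ 2 / t) * (1 + ‖p.2‖ ^ (2 * n)) with hW
  have hWnn : ∀ p, 0 ≤ W p := fun p => by positivity
  have hWfin : ∫⁻ p, ENNReal.ofReal (W p) ≠ ⊤ := by
    have h := hint.2
    rw [hasFiniteIntegral_iff_ofReal (Eventually.of_forall hWnn)] at h
    exact h.ne
  set K := ∫⁻ p, ENNReal.ofReal (W p)
  have hV0 := volume_unitBall_ne_zero (d := d)
  have hVt := volume_unitBall_ne_top (d := d)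
  refine ⟨(K / volume (unitBall d)).toReal, ENNReal.toReal_nonneg, fun x y => ?_⟩
  set e := ENNReal.ofReal (Real.exp ((‖y‖ + 1) ^ 2 / t))
  have hmain : volume (unitBall d) * ‖Φ (complexPoint x y)‖ₑ ^ 2 ≤ K * e := by
    calc volume (unitBall d) * ‖Φ (complexPoint x y)‖ₑ ^ 2
        ≤ ∫⁻ p in unitBall d, ‖Φ (complexPoint (x + p.1) (y + p.2))‖ₑ ^ 2 :=
          enorm_sq_mul_volume_le hΦ x y
      _ ≤ ∫⁻ p in unitBall d, ENNReal.ofReal (W ((x, y) + p)) * e := by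
          refine setLIntegral_mono' measurableSet_unitBall fun p hp => ?_
          have hp2 : ‖p.2‖ ≤ 1 := by
            simp only [unitBall, mem_ofPred_eq] at hp
            nlinarith [norm_nonneg p.1, norm_nonneg p.2]
          rw [← ofReal_norm, ← ENNReal.ofReal_pow (norm_nonneg _), ← ENNReal.ofReal_mul (hWnn _)]
          refine ENNReal.ofReal_le_ofReal ?_
          simp only [hW, Prod.fst_add, Prod.snd_add]
          set a := ‖Φ (complexPoint (x + p.1) (y + p.2))‖ ^ 2
          have hy : ‖y + p.2‖ ≤ ‖y‖ + 1 := (norm_add_le _ _).trans (by linarith)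
          have h1 : 1 ≤ Real.exp (-‖y + p.2‖ ^ 2 / t) * Real.exp ((‖y‖ + 1) ^ 2 / t) := by
            rw [← Real.exp_add, Real.one_le_exp_iff, ← add_div]
            have := pow_le_pow_left₀ (norm_nonneg _) hy 2
            exact div_nonneg (by linarith) ht.le
          have h2 : (1 : ℝ) ≤ 1 + ‖y + p.2‖ ^ (2 * n) := by
            have := pow_nonneg (norm_nonneg (y + p.2)) (2 * n)
            linarith
          calc a = a * (1 * 1) := by ring
            _ ≤ a * ((Real.exp (-‖y + p.2‖ ^ 2 / t) * Real.exp ((‖y‖ + 1) ^ 2 / t)) *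
                (1 + ‖y + p.2‖ ^ (2 * n))) := by gcongr
            _ = _ := by ring
      _ ≤ ∫⁻ p, ENNReal.ofReal (W ((x, y) + p)) * e := setLIntegral_le_lintegral _ _
      _ = (∫⁻ p, ENNReal.ofReal (W ((x, y) + p))) * e :=
          lintegral_mul_const' _ _ ENNReal.ofReal_ne_top
      _ = K * e := by
          have : (volume : Measure (RSpace d × RSpace d)).IsAddLeftInvariant :=
            inferInstanceAs
              ((volume : Measure (RSpace d)).prod (volume : Measure (RSpace d))).IsAddLeftInvariant
          rw [lintegral_add_left_eq_self (fun p => ENNReal.ofReal (W p)) (x, y)]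
  have hdiv : ‖Φ (complexPoint x y)‖ₑ ^ 2 ≤ K / volume (unitBall d) * e := by
    rw [mul_comm, ← ENNReal.le_div_iff_mul_le (Or.inl hV0) (Or.inl hVt)] at hmain
    rwa [ENNReal.mul_div_right_comm] at hmain
  have hfin : K / volume (unitBall d) * e ≠ ⊤ :=
    ENNReal.mul_ne_top (ENNReal.div_ne_top hWfin hV0) ENNReal.ofReal_ne_top
  have := ENNReal.toReal_mono hfin hdiv
  rwa [ENNReal.toReal_pow, toReal_enorm, ENNReal.toReal_mul,
    ENNReal.toReal_ofReal (Real.exp_pos _).le] at this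

/-! ### Shifting the contour of integration -/

lemma integrable_exp_neg_mul_norm_sq {b : ℝ} (hb : 0 < b) :
    Integrable fun x : RSpace d => Real.exp (-b * ‖x‖ ^ 2) := by
  have h := (GaussianFourier.integrable_cexp_neg_mul_sq_norm_add (V := RSpace d)
    (b := (b : ℂ)) (by simpa using hb) 0 0).norm
  refine h.congr (Eventually.of_forall fun x => ?_)
  simp only [norm_exp]
  congr 1
  simp [← ofReal_pow]

/-- For an entire `H` of Gaussian decay in the real directions, locally uniformly in the imaginary
ones, the integral of `H` over `ℝ^d + i y` does not depend on `y`: as a function of `w`, the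
integral over `ℝ^d + i y' + w v` is holomorphic, and it does not change when a real number is added
to `w`. -/
theorem integral_complexPoint_eq {H : CSpace d → ℂ} (hH : Differentiable ℂ H) {ε : ℝ}
    (hε : 0 < ε) {M : ℝ → ℝ} (hM : Monotone M)
    (hb : ∀ x y, ‖H (complexPoint x y)‖ ≤ M ‖y‖ * Real.exp (-ε * ‖x‖ ^ 2)) (y y' : RSpace d) :
    ∫ x, H (complexPoint x y) = ∫ x, H (complexPoint x y') := by
  set v := y - y' with hv
  have hMnn : ∀ a : RSpace d, 0 ≤ M ‖a‖ := fun a => by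
    have h := (norm_nonneg _).trans (hb 0 a)
    simpa using h
  set g : ℂ → ℂ := fun w => ∫ x, H (complexPoint x y' + w • complexPoint v 0) with hg
  have hpt : ∀ (x : RSpace d) (w : ℂ), complexPoint x y' + w • complexPoint v 0 =
      complexPoint (x + w.re • v) (y' + w.im • v) := by
    intro x w
    rw [smul_complexPoint, ← complexPoint_add]
    simp
  have hcont : Continuous fun p : ℂ × RSpace d =>
      H (complexPoint p.2 y' + p.1 • complexPoint v 0) :=
    hH.continuous.comp (((continuous_complexPoint (d := d)).comp
      (by fun_prop : Continuous fun p : ℂ × RSpace d => (p.2, y'))).add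
        (continuous_fst.smul continuous_const))
  have hslice : ∀ x, Differentiable ℂ fun w : ℂ => H (complexPoint x y' + w • complexPoint v 0) :=
    fun x => by fun_prop
  -- A single Gaussian dominates the integrand on each disc of radius `R` about the origin.
  have hdom : ∀ R : ℝ, ∀ w : ℂ, ‖w‖ ≤ R → ∀ x,
      ‖H (complexPoint x y' + w • complexPoint v 0)‖ ≤
        M (‖y'‖ + R * ‖v‖) * Real.exp (ε * (R * ‖v‖) ^ 2) * Real.exp (-(ε / 2) * ‖x‖ ^ 2) := by
    intro R w hw x
    have hre := (abs_re_le_norm w).trans hw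
    have him := (abs_im_le_norm w).trans hw
    have hR : 0 ≤ R := (norm_nonneg _).trans hw
    have h1 : ‖y' + w.im • v‖ ≤ ‖y'‖ + R * ‖v‖ := by
      refine (norm_add_le _ _).trans ?_
      rw [norm_smul, Real.norm_eq_abs]
      gcongr
    have h2 : ‖x‖ ≤ ‖x + w.re • v‖ + R * ‖v‖ := by
      have h3 : ‖w.re • v‖ ≤ R * ‖v‖ := by
        rw [norm_smul, Real.norm_eq_abs]
        gcongr
      have h4 := norm_sub_le (x + w.re • v) (w.re • v)
      rw [add_sub_cancel_right] at h4
      linarith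
    have h5 : ‖x‖ ^ 2 ≤ 2 * ‖x + w.re • v‖ ^ 2 + 2 * (R * ‖v‖) ^ 2 := by
      have := pow_le_pow_left₀ (norm_nonneg x) h2 2
      nlinarith [sq_nonneg (‖x + w.re • v‖ - R * ‖v‖)]
    rw [hpt]
    refine (hb _ _).trans ?_
    rw [mul_assoc, ← Real.exp_add]
    have h6 := hM h1
    have h7 := hMnn (y' + w.im • v)
    refine mul_le_mul h6 (Real.exp_le_exp.2 ?_) (Real.exp_pos _).le (h7.trans h6)
    nlinarith
  have hdomint : ∀ c : ℝ, Integrable fun x : RSpace d => c * Real.exp (-(ε / 2) * ‖x‖ ^ 2) :=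
    fun c => (integrable_exp_neg_mul_norm_sq (half_pos hε)).const_mul c
  have hgd : ∀ w₀, ∃ g', HasDerivAt g g' w₀ := by
    intro w₀
    refine ⟨_, (hasDerivAt_integral_of_dominated_loc_of_deriv_le
      (F := fun (w : ℂ) (x : RSpace d) => H (complexPoint x y' + w • complexPoint v 0))
      (F' := fun (w : ℂ) (x : RSpace d) =>
        deriv (fun w : ℂ => H (complexPoint x y' + w • complexPoint v 0)) w)
      (bound := fun x => M (‖y'‖ + (‖w₀‖ + 2) * ‖v‖) *
        Real.exp (ε * ((‖w₀‖ + 2) * ‖v‖) ^ 2) * Real.exp (-(ε / 2) * ‖x‖ ^ 2))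
      (s := Metric.ball w₀ 1) (Metric.ball_mem_nhds _ one_pos) ?_ ?_ ?_ ?_ (hdomint _) ?_).2⟩
    · refine Eventually.of_forall fun w => Continuous.aestronglyMeasurable ?_
      exact hcont.comp (by fun_prop : Continuous fun x : RSpace d => (w, x))
    · refine (hdomint _).mono' (hcont.comp
        (by fun_prop : Continuous fun x : RSpace d => (w₀, x))).aestronglyMeasurable
        (Eventually.of_forall (hdom (‖w₀‖ + 2) w₀ (by linarith)))
    · have h := measurable_deriv_with_param (𝕜 := ℂ) (α := RSpace d)
        (f := fun x w => H (complexPoint x y' + w • complexPoint v 0))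
        (hcont.comp continuous_swap)
      exact (h.comp (measurable_id.prodMk measurable_const)).aestronglyMeasurable
    · refine Eventually.of_forall fun x w hw => ?_
      refine (norm_deriv_le_of_forall_mem_sphere_norm_le one_pos
        (hslice x).diffContOnCl (fun w' hw' => ?_)).trans_eq (div_one _)
      refine hdom _ w' ?_ x
      rw [mem_ball_iff_norm] at hw
      rw [mem_sphere_iff_norm] at hw'
      calc ‖w'‖ = ‖(w' - w) + (w - w₀) + w₀‖ := by congr 1; ring
        _ ≤ ‖w' - w‖ + ‖w - w₀‖ + ‖w₀‖ := norm_add₃_le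
        _ ≤ ‖w₀‖ + 2 := by linarith
    · exact Eventually.of_forall fun x w _ => ((hslice x) w).hasDerivAt
  have hshift : ∀ (w : ℂ) (s : ℝ), g (w + s) = g w := by
    intro w s
    have : ∀ x : RSpace d, complexPoint x y' + (w + s) • complexPoint v 0 =
        complexPoint (x + s • v) y' + w • complexPoint v 0 := by
      intro x
      rw [hpt, hpt]
      congr 1
      · simp only [add_re, ofReal_re]
        module
      · simp
    simp only [hg, this]
    exact integral_add_right_eq_self
      (fun x => H (complexPoint x y' + w • complexPoint v 0)) (s • v)
  have hderiv : ∀ w, deriv g w = 0 := by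
    intro w
    obtain ⟨g', hg'⟩ := hgd w
    have hcurve : HasDerivAt (fun s : ℝ => w + (s : ℂ)) 1 0 := by
      simpa using (ofRealCLM.hasDerivAt (x := 0)).const_add w
    have hg0 : HasDerivAt g g' (w + ((0 : ℝ) : ℂ)) := by simpa using hg'
    have h1 := HasDerivAt.comp (h₂ := g) (h := fun s : ℝ => w + (s : ℂ)) (0 : ℝ) hg0 hcurve
    simp only [Function.comp_def, hshift] at h1
    have h2 := h1.unique (hasDerivAt_const 0 (g w))
    rw [hg'.deriv]
    simpa using h2
  have hconst := is_const_of_deriv_eq_zero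
    (fun w => (hgd w).choose_spec.differentiableAt) hderiv I 0
  have hI : ∀ x : RSpace d, complexPoint x y' + I • complexPoint v 0 = complexPoint x y := by
    intro x
    rw [hpt, hv]
    simp
  simpa [hg, hI] using hconst

/-- The bilinear extension of the inner product, with a complex first argument. -/
noncomputable def complexInner (z : CSpace d) (ξ : RSpace d) : ℂ := ∑ j, z j * (ξ j : ℂ)

/-- The holomorphic extension `∑ j, z_j ^ 2` of the squared norm of `ℝ^d`. -/
noncomputable def complexNormSq (z : CSpace d) : ℂ := ∑ j, z j ^ 2

lemma complexInner_complexPoint (x y ξ : RSpace d) :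
    complexInner (complexPoint x y) ξ = (⟪x, ξ⟫ : ℂ) + I * (⟪y, ξ⟫ : ℂ) := by
  simp only [complexInner, complexPoint_apply, PiLp.inner_apply, ofReal_sum, Finset.mul_sum,
    ← Finset.sum_add_distrib]
  refine Finset.sum_congr rfl fun j _ => ?_
  simp
  ring

lemma complexNormSq_complexPoint (x y : RSpace d) :
    complexNormSq (complexPoint x y) = ((‖x‖ ^ 2 - ‖y‖ ^ 2 : ℝ) : ℂ) + 2 * I * (⟪x, y⟫ : ℂ) := by
  simp only [complexNormSq, complexPoint_apply, PiLp.inner_apply, EuclideanSpace.real_norm_sq_eq,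
    ← Finset.sum_sub_distrib, ofReal_sum, Finset.mul_sum, ← Finset.sum_add_distrib]
  refine Finset.sum_congr rfl fun j _ => ?_
  simp
  linear_combination (y j : ℂ) ^ 2 * I_sq

lemma differentiable_complexInner (ξ : RSpace d) :
    Differentiable ℂ fun z : CSpace d => complexInner z ξ := by
  unfold complexInner
  fun_prop

lemma differentiable_complexNormSq :
    Differentiable ℂ fun z : CSpace d => complexNormSq z := by
  unfold complexNormSq
  fun_prop

/-- The slice `x ↦ Φ(x + iy)`, regularized by the holomorphic Gaussian `e^{-ε z·z}`. -/
noncomputable def gaussianSlice (ε : ℝ) (Φ : CSpace d → ℂ) (y x : RSpace d) : ℂ :=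
  Φ (complexPoint x y) * exp (-(ε : ℂ) * complexNormSq (complexPoint x y))

lemma norm_gaussianSlice (ε : ℝ) (Φ : CSpace d → ℂ) (y x : RSpace d) :
    ‖gaussianSlice ε Φ y x‖ =
      ‖Φ (complexPoint x y)‖ * (Real.exp (ε * ‖y‖ ^ 2) * Real.exp (-ε * ‖x‖ ^ 2)) := by
  rw [gaussianSlice, norm_mul, norm_exp, complexNormSq_complexPoint, ← Real.exp_add]
  congr 2
  have hre : ∀ r : ℝ, ((r : ℂ) ^ 2).re = r ^ 2 := fun r => by rw [← ofReal_pow, ofReal_re]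
  simp [hre]
  ring

lemma continuous_gaussianSlice (ε : ℝ) {Φ : CSpace d → ℂ} (hΦ : Continuous Φ) (y : RSpace d) :
    Continuous (gaussianSlice ε Φ y) := by
  have hc : Continuous fun x : RSpace d => complexPoint x y :=
    (continuous_complexPoint (d := d)).comp (by fun_prop : Continuous fun x => (x, y))
  exact (hΦ.comp hc).mul (continuous_exp.comp (continuous_const.mul
    ((differentiable_complexNormSq (d := d)).continuous.comp hc)))

/-- The Fourier transforms of the regularized slices of an entire function satisfy
`e^{2π y·ξ} 𝓕(Φ_y)(ξ) = e^{2π y'·ξ} 𝓕(Φ_{y'})(ξ)`. -/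
theorem exp_mul_fourier_gaussianSlice {Φ : CSpace d → ℂ} (hΦ : Differentiable ℂ Φ) {M : ℝ → ℝ}
    (hM : Monotone M) (hb : ∀ x y, ‖Φ (complexPoint x y)‖ ≤ M ‖y‖) {ε : ℝ} (hε : 0 < ε)
    (y y' ξ : RSpace d) :
    exp ((2 * Real.pi * ⟪y, ξ⟫ : ℝ) : ℂ) * 𝓕 (gaussianSlice ε Φ y) ξ =
      exp ((2 * Real.pi * ⟪y', ξ⟫ : ℝ) : ℂ) * 𝓕 (gaussianSlice ε Φ y') ξ := by
  set H : CSpace d → ℂ := fun z =>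
    exp (-2 * Real.pi * I * complexInner z ξ) * (Φ z * exp (-(ε : ℂ) * complexNormSq z)) with hH
  have hHd : Differentiable ℂ H := by
    have h1 := differentiable_complexInner ξ
    have h2 := differentiable_complexNormSq (d := d)
    fun_prop
  have hMnn : ∀ a : RSpace d, 0 ≤ M ‖a‖ := fun a => (norm_nonneg _).trans (hb 0 a)
  have hHy : ∀ x y, H (complexPoint x y) = exp ((2 * Real.pi * ⟪y, ξ⟫ : ℝ) : ℂ) *
      (exp ((-2 * Real.pi * ⟪x, ξ⟫ : ℝ) * I) * gaussianSlice ε Φ y x) := by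
    intro x y
    simp only [hH, gaussianSlice, complexInner_complexPoint]
    rw [← mul_assoc (exp _) (exp _), ← exp_add]
    congr 2
    push_cast
    linear_combination (-2 * Real.pi * ⟪y, ξ⟫ : ℂ) * I_mul_I
  have hfour : ∀ y, exp ((2 * Real.pi * ⟪y, ξ⟫ : ℝ) : ℂ) * 𝓕 (gaussianSlice ε Φ y) ξ =
      ∫ x, H (complexPoint x y) := by
    intro y
    simp only [hHy, Real.fourier_eq', smul_eq_mul]
    rw [integral_const_mul]
  rw [hfour, hfour]
  -- The bound has to be monotone in `‖y‖` on all of `ℝ`, hence the truncations at `0`.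
  refine integral_complexPoint_eq hHd hε
    (M := fun r => max (M r) 0 * Real.exp (2 * Real.pi * (max r 0 * ‖ξ‖) + ε * (max r 0) ^ 2))
    ?_ ?_ y y'
  · intro a b hab
    dsimp only
    have := hM hab
    gcongr
  · intro x y
    rw [hHy, norm_mul, norm_mul, norm_exp_ofReal_mul_I, one_mul, norm_gaussianSlice, norm_exp,
      ofReal_re, max_eq_left (hMnn y), max_eq_left (norm_nonneg y), Real.exp_add]
    have h1 : ⟪y, ξ⟫ ≤ ‖y‖ * ‖ξ‖ := real_inner_le_norm y ξ
    calc Real.exp (2 * Real.pi * ⟪y, ξ⟫) * (‖Φ (complexPoint x y)‖ *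
          (Real.exp (ε * ‖y‖ ^ 2) * Real.exp (-ε * ‖x‖ ^ 2)))
        ≤ Real.exp (2 * Real.pi * (‖y‖ * ‖ξ‖)) * (M ‖y‖ *
          (Real.exp (ε * ‖y‖ ^ 2) * Real.exp (-ε * ‖x‖ ^ 2))) := by
          gcongr
          exact hb x y
      _ = _ := by ring

/-! ### The Fourier transform on `L²` -/

lemma eLpNorm_two_sq {α : Type*} [MeasurableSpace α] {μ : Measure α} (f : α → ℂ) :
    eLpNorm f 2 μ ^ 2 = ∫⁻ x, ‖f x‖ₑ ^ 2 ∂μ := by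
  have h := eLpNorm_nnreal_pow_eq_lintegral (f := f) (μ := μ) (p := 2) two_ne_zero
  simpa using h

lemma memLp_two_iff_lintegral {α : Type*} [MeasurableSpace α] {μ : Measure α} {f : α → ℂ}
    (hf : AEStronglyMeasurable f μ) : MemLp f 2 μ ↔ ∫⁻ x, ‖f x‖ₑ ^ 2 ∂μ < ⊤ := by
  rw [← eLpNorm_two_sq, MemLp, and_iff_right hf]
  simp

/-- A locally integrable function is determined by its pairings with Schwartz functions. -/
lemma ae_eq_of_integral_schwartz_mul_eq {u v : RSpace d → ℂ} (hu : LocallyIntegrable u)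
    (hv : LocallyIntegrable v)
    (h : ∀ φ : 𝓢(RSpace d, ℂ), ∫ x, φ x * u x = ∫ x, φ x * v x) : u =ᵐ[volume] v := by
  refine ae_eq_of_integral_contDiff_smul_eq hu hv fun g hg hgc => ?_
  have h1 : HasCompactSupport (ofRealCLM ∘ g) := hgc.comp_left rfl
  have h2 : ContDiff ℝ ∞ (ofRealCLM ∘ g) := by fun_prop
  simpa using h (h1.toSchwartzMap h2)

lemma integral_fourier_schwartz_mul (φ : 𝓢(RSpace d, ℂ)) {h : RSpace d → ℂ}
    (hi : Integrable h) : ∫ x, (𝓕 φ) x * h x = ∫ x, φ x * 𝓕 h x := by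
  have := VectorFourier.integral_bilin_fourierIntegral_eq_flip (ContinuousLinearMap.mul ℂ ℂ)
    (L := innerₗ (RSpace d)) (μ := volume) (ν := volume) (f := φ) (g := h)
    Real.continuous_fourierChar continuous_inner φ.integrable hi
  simpa using! this

lemma integral_fourierInv_schwartz_mul (φ : 𝓢(RSpace d, ℂ)) {h : RSpace d → ℂ}
    (hi : Integrable h) : ∫ x, (𝓕⁻ φ) x * h x = ∫ x, φ x * 𝓕⁻ h x := by
  have h1 := integral_fourier_schwartz_mul φ hi.comp_neg
  rw [← integral_neg_eq_self] at h1
  rw [Real.fourierInv_eq_fourier_comp_neg h, ← h1]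
  refine integral_congr_ae (Eventually.of_forall fun x => ?_)
  simp only [neg_neg]
  rw [SchwartzMap.fourierInv_coe, Real.fourierInv_eq_fourier_neg, SchwartzMap.fourier_coe]

lemma continuous_fourier {h : RSpace d → ℂ} (hi : Integrable h) : Continuous (𝓕 h) :=
  VectorFourier.fourierIntegral_continuous Real.continuous_fourierChar continuous_inner hi

lemma continuous_fourierInv {h : RSpace d → ℂ} (hi : Integrable h) : Continuous (𝓕⁻ h) := by
  rw [Real.fourierInv_eq_fourier_comp_neg]
  exact continuous_fourier hi.comp_neg

lemma locallyIntegrable_coe (f : L2Space d) : LocallyIntegrable f :=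
  (Lp.memLp f).locallyIntegrable one_le_two

/-- On `L¹ ∩ L²`, the `L²` Fourier transform is given by the Fourier integral. -/
theorem fourier_toLp_ae_eq {h : RSpace d → ℂ} (hi : Integrable h) (h2 : MemLp h 2) :
    (𝓕 (h2.toLp h) : L2Space d) =ᵐ[volume] 𝓕 h := by
  refine ae_eq_of_integral_schwartz_mul_eq (locallyIntegrable_coe _)
    (continuous_fourier hi).locallyIntegrable fun φ => ?_
  have key := DFunLike.congr_fun (Lp.fourier_toTemperedDistribution_eq (h2.toLp h)) φ
  simp only [TemperedDistribution.fourier_apply, Lp.toTemperedDistribution_apply,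
    smul_eq_mul] at key
  rw [← key, ← integral_fourier_schwartz_mul φ hi]
  refine integral_congr_ae ?_
  filter_upwards [h2.coeFn_toLp] with x hx
  rw [hx]

/-- On `L¹ ∩ L²`, the inverse `L²` Fourier transform is given by the inverse Fourier integral. -/
theorem fourierInv_toLp_ae_eq {h : RSpace d → ℂ} (hi : Integrable h) (h2 : MemLp h 2) :
    (𝓕⁻ (h2.toLp h) : L2Space d) =ᵐ[volume] 𝓕⁻ h := by
  refine ae_eq_of_integral_schwartz_mul_eq (locallyIntegrable_coe _)
    (continuous_fourierInv hi).locallyIntegrable fun φ => ?_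
  have key := DFunLike.congr_fun (Lp.fourierInv_toTemperedDistribution_eq (h2.toLp h)) φ
  simp only [TemperedDistribution.fourierInv_apply, Lp.toTemperedDistribution_apply,
    smul_eq_mul] at key
  rw [← key, ← integral_fourierInv_schwartz_mul φ hi]
  refine integral_congr_ae ?_
  filter_upwards [h2.coeFn_toLp] with x hx
  rw [hx]

lemma lintegral_enorm_sq_coe (f : L2Space d) : ∫⁻ x, ‖f x‖ₑ ^ 2 = ‖f‖ₑ ^ 2 := by
  rw [← eLpNorm_two_sq, Lp.enorm_def]

lemma lintegral_enorm_sq_fourier (f : L2Space d) :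
    ∫⁻ ξ, ‖(𝓕 f : L2Space d) ξ‖ₑ ^ 2 = ∫⁻ x, ‖f x‖ₑ ^ 2 := by
  rw [lintegral_enorm_sq_coe, lintegral_enorm_sq_coe, ← ofReal_norm, Lp.norm_fourier_eq,
    ofReal_norm]

lemma lintegral_enorm_sq_fourierInv {h : RSpace d → ℂ} (hi : Integrable h) (h2 : MemLp h 2) :
    ∫⁻ x, ‖𝓕⁻ h x‖ₑ ^ 2 = ∫⁻ ξ, ‖h ξ‖ₑ ^ 2 := by
  have h3 : ∫⁻ x, ‖(𝓕⁻ (h2.toLp h) : L2Space d) x‖ₑ ^ 2 = ∫⁻ x, ‖h2.toLp h x‖ₑ ^ 2 := by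
    rw [← lintegral_enorm_sq_fourier, fourier_fourierInv_eq]
  have h4 : ∫⁻ x, ‖(𝓕⁻ (h2.toLp h) : L2Space d) x‖ₑ ^ 2 = ∫⁻ x, ‖𝓕⁻ h x‖ₑ ^ 2 :=
    lintegral_congr_ae ((fourierInv_toLp_ae_eq hi h2).mono fun x hx => by simp only [hx])
  have h5 : ∫⁻ x, ‖h2.toLp h x‖ₑ ^ 2 = ∫⁻ ξ, ‖h ξ‖ₑ ^ 2 :=
    lintegral_congr_ae (h2.coeFn_toLp.mono fun x hx => by simp only [hx])
  rw [← h4, h3, h5]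

/-- Parseval's identity, for the pairing of the Fourier integral of an `L¹ ∩ L²` function with an
`L²` function. -/
theorem integral_conj_mul_eq_fourier {h : RSpace d → ℂ} (hi : Integrable h) (h2 : MemLp h 2)
    (f : L2Space d) :
    ∫ x, conj (h x) * f x = ∫ ξ, conj (𝓕 h ξ) * (𝓕 f : L2Space d) ξ := by
  have key := Lp.inner_fourier_eq (h2.toLp h) f
  rw [L2.inner_def, L2.inner_def] at key
  have h3 : ∫ ξ, inner ℂ ((𝓕 (h2.toLp h) : L2Space d) ξ) ((𝓕 f : L2Space d) ξ) =
      ∫ ξ, conj (𝓕 h ξ) * (𝓕 f : L2Space d) ξ :=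
    integral_congr_ae ((fourier_toLp_ae_eq hi h2).mono fun x hx => by simp [hx, mul_comm])
  have h4 : ∫ x, inner ℂ (h2.toLp h x) (f x) = ∫ x, conj (h x) * f x :=
    integral_congr_ae (h2.coeFn_toLp.mono fun x hx => by simp [hx, mul_comm])
  rw [← h3, ← h4, key]

/-! ### The Fourier side of the Sobolev condition -/

/-- The Fourier symbol `∏ i, 2πi ⟨ξ, m i⟩` of the iterated directional derivative `∂^{m}`. -/
noncomputable def derivSymbol {k : ℕ} (m : Fin k → RSpace d) (ξ : RSpace d) : ℂ :=
  ∏ i, (2 * Real.pi * I * (⟪ξ, m i⟫ : ℂ))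

lemma hasTemperateGrowth_derivSymbol {k : ℕ} (m : Fin k → RSpace d) :
    (derivSymbol m).HasTemperateGrowth := by
  induction k with
  | zero =>
    have h : derivSymbol m = fun _ => (1 : ℂ) := by
      funext ξ
      simp [derivSymbol]
    rw [h]
    exact Function.HasTemperateGrowth.const 1
  | succ k ih =>
    have h : derivSymbol m = fun ξ =>
        (2 * Real.pi * I * (⟪ξ, m 0⟫ : ℂ)) * derivSymbol (Fin.tail m) ξ := by
      funext ξ
      simp [derivSymbol, Fin.prod_univ_succ, Fin.tail]
    rw [h]
    have := ih (Fin.tail m)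
    fun_prop

lemma fourier_iteratedLineDerivOp {k : ℕ} (m : Fin k → RSpace d) (T : 𝓢'(RSpace d, ℂ)) :
    𝓕 (∂^{m} T) = TemperedDistribution.smulLeftCLM ℂ (derivSymbol m) (𝓕 T) := by
  induction k with
  | zero =>
    have h : derivSymbol m = fun _ => (1 : ℂ) := by
      funext ξ
      simp [derivSymbol]
    rw [h, TemperedDistribution.smulLeftCLM_const, one_smul, LineDeriv.iteratedLineDerivOp_fin_zero]
  | succ k ih =>
    have hg : (fun ξ : RSpace d => (⟪ξ, m 0⟫ : ℂ)).HasTemperateGrowth := by fun_prop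
    rw [LineDeriv.iteratedLineDerivOp_succ_left, TemperedDistribution.fourier_lineDerivOp_eq, ih,
      TemperedDistribution.smulLeftCLM_smulLeftCLM_apply (hasTemperateGrowth_derivSymbol _)
        hg,
      ← smul_apply, ← TemperedDistribution.smulLeftCLM_smul
        ((hasTemperateGrowth_derivSymbol _).mul hg)]
    congr 2
    funext ξ
    simp [derivSymbol, Fin.prod_univ_succ, Fin.tail]
    ring

/-- A product of a function of temperate growth and an `L²` function is represented, as a tempered
distribution, by the pointwise product. -/
lemma smulLeftCLM_coe_eq_coe_iff {g : RSpace d → ℂ} (hg : g.HasTemperateGrowth) (u v : L2Space d) :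
    TemperedDistribution.smulLeftCLM ℂ g (u : 𝓢'(RSpace d, ℂ)) = (v : 𝓢'(RSpace d, ℂ)) ↔
      (fun ξ => g ξ * u ξ) =ᵐ[volume] v := by
  have hl : ∀ φ : 𝓢(RSpace d, ℂ),
      TemperedDistribution.smulLeftCLM ℂ g (u : 𝓢'(RSpace d, ℂ)) φ = ∫ ξ, φ ξ * (g ξ * u ξ) := by
    intro φ
    rw [TemperedDistribution.smulLeftCLM_apply_apply, Lp.toTemperedDistribution_apply]
    refine integral_congr_ae (Eventually.of_forall fun ξ => ?_)
    simp only [SchwartzMap.smulLeftCLM_apply_apply hg, smul_eq_mul]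
    ring
  have hr : ∀ φ : 𝓢(RSpace d, ℂ), (v : 𝓢'(RSpace d, ℂ)) φ = ∫ ξ, φ ξ * v ξ := by
    intro φ
    simp [Lp.toTemperedDistribution_apply]
  constructor
  · intro h
    refine ae_eq_of_integral_schwartz_mul_eq ?_ (locallyIntegrable_coe v) fun φ => ?_
    · exact (locallyIntegrable_coe u).continuous_mul hg.1.continuous
    · rw [← hl, ← hr, h]
  · intro h
    ext φ
    rw [hl, hr]
    refine integral_congr_ae ?_
    filter_upwards [h] with ξ hξ
    rw [hξ]

lemma pow_two_mul_le_one_add {a : ℝ} (ha : 0 ≤ a) {k n : ℕ} (hk : k ≤ n) :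
    a ^ (2 * k) ≤ 1 + a ^ (2 * n) := by
  have h := pow_nonneg ha (2 * n)
  rcases le_total a 1 with h1 | h1
  · have := pow_le_one₀ (n := 2 * k) ha h1
    linarith
  · have := pow_le_pow_right₀ h1 (Nat.mul_le_mul_left 2 hk)
    linarith

lemma norm_pow_le_sum_abs_pow {n : ℕ} (hn : 0 < n) (ξ : RSpace d) :
    ‖ξ‖ ^ (2 * n) ≤ (d : ℝ) ^ n * ∑ j, |ξ j| ^ (2 * n) := by
  obtain ⟨m, rfl⟩ := Nat.exists_eq_succ_of_ne_zero hn.ne'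
  rcases Nat.eq_zero_or_pos d with rfl | hd
  · have : ξ = 0 := Subsingleton.elim _ _
    simp [this]
  have h := pow_sum_div_card_le_sum_pow (s := Finset.univ) (f := fun j : Fin d => |ξ j| ^ 2)
    (fun j _ => by positivity) m
  have hd' : (1 : ℝ) ≤ d := by exact_mod_cast hd
  rw [Finset.card_univ, Fintype.card_fin, div_le_iff₀ (by positivity)] at h
  rw [pow_mul, EuclideanSpace.real_norm_sq_eq]
  simp only [pow_mul]
  simp only [sq_abs] at h ⊢
  refine h.trans ?_
  rw [mul_comm]
  gcongr
  exact Nat.le_succ m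

lemma norm_derivSymbol_le {k : ℕ} (j : Fin k → Fin d) (ξ : RSpace d) :
    ‖derivSymbol (fun i => EuclideanSpace.single (j i) (1 : ℝ)) ξ‖ ≤
      (2 * Real.pi * ‖ξ‖) ^ k := by
  rw [derivSymbol, norm_prod]
  refine (Finset.prod_le_prod (g := fun _ => 2 * Real.pi * ‖ξ‖) (fun i _ => norm_nonneg _)
    fun i _ => ?_).trans_eq (by simp)
  have h := abs_real_inner_le_norm ξ (EuclideanSpace.single (j i) (1 : ℝ))
  simp only [PiLp.norm_single, norm_one, mul_one] at h
  simp only [norm_mul, norm_I, norm_real, Real.norm_eq_abs, abs_of_pos Real.pi_pos,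
    Complex.norm_ofNat, mul_one]
  gcongr

lemma abs_pow_le_norm_derivSymbol (n : ℕ) (j : Fin d) (ξ : RSpace d) :
    |ξ j| ^ n ≤ ‖derivSymbol (fun _ : Fin n => EuclideanSpace.single j (1 : ℝ)) ξ‖ := by
  have h2π : (1 : ℝ) ≤ 2 * Real.pi := by linarith [Real.pi_gt_three]
  simp only [derivSymbol, Finset.prod_const, Finset.card_univ, Fintype.card_fin, norm_pow,
    norm_mul, norm_I, norm_real, Real.norm_eq_abs, abs_of_pos Real.pi_pos, Complex.norm_ofNat,
    mul_one, EuclideanSpace.inner_single_right]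
  refine pow_le_pow_left₀ (abs_nonneg _) ?_ n
  simp only [abs_one, one_mul, conj_trivial]
  exact le_mul_of_one_le_left (abs_nonneg _) h2π

/-- Membership in the Sobolev space `H^n` is a weighted `L²` condition on the Fourier
transform. -/
theorem memSobolev_iff_lintegral {n : ℕ} (hn : 0 < n) (f : L2Space d) :
    MemSobolev n f ↔
      ∫⁻ ξ, ‖(𝓕 f : L2Space d) ξ‖ₑ ^ 2 * ENNReal.ofReal (1 + ‖ξ‖ ^ (2 * n)) < ⊤ := by
  set G : L2Space d := 𝓕 f with hG
  have hGm : AEStronglyMeasurable G volume := (Lp.memLp G).1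
  have hG2 : ∫⁻ ξ, ‖G ξ‖ₑ ^ 2 < ⊤ := (memLp_two_iff_lintegral hGm).1 (Lp.memLp G)
  constructor
  · intro h
    -- Pure derivatives of order `n` suffice for this direction.
    have hj : ∀ j : Fin d, ∫⁻ ξ, ENNReal.ofReal (|ξ j| ^ (2 * n)) * ‖G ξ‖ₑ ^ 2 < ⊤ := by
      intro j
      obtain ⟨g, hg⟩ := h n le_rfl fun _ => j
      have h1 := congrArg (fun T : 𝓢'(RSpace d, ℂ) => 𝓕 T) hg
      simp only [fourier_iteratedLineDerivOp, Lp.fourier_toTemperedDistribution_eq] at h1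
      rw [smulLeftCLM_coe_eq_coe_iff (hasTemperateGrowth_derivSymbol _)] at h1
      have h2 := (memLp_two_iff_lintegral (Lp.memLp (𝓕 g)).1).1 (Lp.memLp (𝓕 g))
      refine lt_of_le_of_lt (lintegral_mono_ae ?_) h2
      filter_upwards [h1] with ξ hξ
      rw [← hξ, enorm_mul, mul_pow]
      gcongr
      rw [← ofReal_norm, ← ENNReal.ofReal_pow (norm_nonneg _), mul_comm 2 n, pow_mul]
      gcongr
      exact abs_pow_le_norm_derivSymbol n j ξ
    have hm : ∀ j : Fin d, AEMeasurable
        (fun ξ : RSpace d => ENNReal.ofReal (|ξ j| ^ (2 * n)) * ‖G ξ‖ₑ ^ 2) volume := by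
      intro j
      refine AEMeasurable.mul ?_ (hGm.enorm.pow_const 2)
      exact (by fun_prop : Measurable fun ξ : RSpace d =>
        ENNReal.ofReal (|ξ j| ^ (2 * n))).aemeasurable
    calc ∫⁻ ξ, ‖G ξ‖ₑ ^ 2 * ENNReal.ofReal (1 + ‖ξ‖ ^ (2 * n))
        ≤ ∫⁻ ξ, (‖G ξ‖ₑ ^ 2 + ENNReal.ofReal ((d : ℝ) ^ n) *
            ∑ j, ENNReal.ofReal (|ξ j| ^ (2 * n)) * ‖G ξ‖ₑ ^ 2) := by
          refine lintegral_mono fun ξ => ?_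
          rw [← Finset.sum_mul, ← ENNReal.ofReal_sum_of_nonneg (fun j _ => by positivity),
            ← mul_assoc, ← ENNReal.ofReal_mul (by positivity), ENNReal.ofReal_add zero_le_one
            (by positivity), ENNReal.ofReal_one, mul_add, mul_one, mul_comm (‖G ξ‖ₑ ^ 2)]
          gcongr
          exact norm_pow_le_sum_abs_pow hn ξ
      _ = (∫⁻ ξ, ‖G ξ‖ₑ ^ 2) + ENNReal.ofReal ((d : ℝ) ^ n) *
            ∑ j, ∫⁻ ξ, ENNReal.ofReal (|ξ j| ^ (2 * n)) * ‖G ξ‖ₑ ^ 2 := by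
          rw [lintegral_add_left' (hGm.enorm.pow_const 2),
            lintegral_const_mul' _ _ ENNReal.ofReal_ne_top,
            lintegral_finsetSum' _ fun j _ => hm j]
      _ < ⊤ := by
          refine ENNReal.add_lt_top.2 ⟨hG2, ENNReal.mul_lt_top ENNReal.ofReal_lt_top ?_⟩
          exact ENNReal.sum_lt_top.2 fun j _ => hj j
  · intro h k hk j
    set m : Fin k → RSpace d := fun i => EuclideanSpace.single (j i) (1 : ℝ)
    have hgm : AEStronglyMeasurable (fun ξ => derivSymbol m ξ * G ξ) volume :=
      (hasTemperateGrowth_derivSymbol m).1.continuous.aestronglyMeasurable.mul hGm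
    have hmem : MemLp (fun ξ => derivSymbol m ξ * G ξ) 2 volume := by
      rw [memLp_two_iff_lintegral hgm]
      calc ∫⁻ ξ, ‖derivSymbol m ξ * G ξ‖ₑ ^ 2
          ≤ ∫⁻ ξ, ENNReal.ofReal ((2 * Real.pi) ^ (2 * k)) *
              (‖G ξ‖ₑ ^ 2 * ENNReal.ofReal (1 + ‖ξ‖ ^ (2 * n))) := by
            refine lintegral_mono fun ξ => ?_
            rw [mul_left_comm, ← ENNReal.ofReal_mul (by positivity), enorm_mul, mul_pow,
              mul_comm (‖derivSymbol m ξ‖ₑ ^ 2), ← ofReal_norm (derivSymbol m ξ),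
              ← ENNReal.ofReal_pow (norm_nonneg _)]
            gcongr
            calc ‖derivSymbol m ξ‖ ^ 2 ≤ ((2 * Real.pi * ‖ξ‖) ^ k) ^ 2 := by
                  gcongr
                  exact norm_derivSymbol_le j ξ
              _ = (2 * Real.pi) ^ (2 * k) * ‖ξ‖ ^ (2 * k) := by ring
              _ ≤ _ := by
                  gcongr
                  exact pow_two_mul_le_one_add (norm_nonneg ξ) hk
        _ < ⊤ := by
            rw [lintegral_const_mul' _ _ ENNReal.ofReal_ne_top]
            exact ENNReal.mul_lt_top ENNReal.ofReal_lt_top h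
    refine ⟨𝓕⁻ (hmem.toLp _), ?_⟩
    have h1 : 𝓕 (∂^{m} (f : 𝓢'(RSpace d, ℂ))) = (hmem.toLp _ : L2Space d) := by
      rw [fourier_iteratedLineDerivOp, Lp.fourier_toTemperedDistribution_eq,
        smulLeftCLM_coe_eq_coe_iff (hasTemperateGrowth_derivSymbol _)]
      exact hmem.coeFn_toLp.symm
    rw [← Lp.fourierInv_toTemperedDistribution_eq, ← h1, fourierInv_fourier_eq]

/-! ### The heat transform as an entire function -/

lemma memLp_exp_neg_mul_norm_sq {b : ℝ} (hb : 0 < b) :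
    MemLp (fun x : RSpace d => Real.exp (-b * ‖x‖ ^ 2)) 2 := by
  rw [memLp_two_iff_integrable_sq (by fun_prop)]
  refine (integrable_exp_neg_mul_norm_sq (d := d) (b := 2 * b) (by positivity)).congr
    (Eventually.of_forall fun x => ?_)
  simp only
  rw [← Real.exp_nat_mul]
  congr 1
  push_cast
  ring

/-- A Gaussian beats every exponential: `e^{-c r² + b r}` is bounded by a multiple of
`e^{-(c/2) r²}`. -/
lemma exp_neg_mul_sq_add_mul_le {c : ℝ} (hc : 0 < c) (b r : ℝ) :
    Real.exp (-c * r ^ 2 + b * r) ≤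
      Real.exp (b ^ 2 / (2 * c)) * Real.exp (-(c / 2) * r ^ 2) := by
  rw [← Real.exp_add, Real.exp_le_exp]
  have h : b ^ 2 / (2 * c) + -(c / 2) * r ^ 2 - (-c * r ^ 2 + b * r) =
      (b - c * r) ^ 2 / (2 * c) := by
    field_simp
    ring
  have : 0 ≤ (b - c * r) ^ 2 / (2 * c) := by positivity
  linarith

/-- Multiplication by a kernel of Gaussian decay maps `L²` to `L¹ ∩ L²`. -/
lemma integrable_and_memLp_mul {K G : RSpace d → ℂ} (hG : MemLp G 2)
    (hK : AEStronglyMeasurable K volume) {A c : ℝ} (hc : 0 < c)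
    (hb : ∀ ξ, ‖K ξ‖ ≤ A * Real.exp (-c * ‖ξ‖ ^ 2)) :
    Integrable (fun ξ => K ξ * G ξ) ∧ MemLp (fun ξ => K ξ * G ξ) 2 := by
  have hK2 : MemLp K 2 := by
    refine ((memLp_exp_neg_mul_norm_sq hc).const_mul A).mono hK (Eventually.of_forall fun ξ => ?_)
    exact (hb ξ).trans (le_abs_self _)
  have hKi : MemLp K ⊤ := by
    refine memLp_top_of_bound hK A (Eventually.of_forall fun ξ => (hb ξ).trans ?_)
    have hA : 0 ≤ A := by
      have h := (norm_nonneg _).trans (hb ξ)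
      exact nonneg_of_mul_nonneg_left h (Real.exp_pos _)
    refine mul_le_of_le_one_right hA (Real.exp_le_one_iff.2 ?_)
    nlinarith [sq_nonneg ‖ξ‖]
  exact ⟨hK2.integrable_mul hG, hG.mul hKi⟩

/-- The Fourier density `e^{-2π²t|ξ|² - 2π y·ξ} G(ξ)` of the slice `x ↦ Φ(x + iy)` of the heat
transform `Φ` with initial spectrum `G`. -/
noncomputable def sliceDensity (t : ℝ) (G : RSpace d → ℂ) (y ξ : RSpace d) : ℂ :=
  ((Real.exp (-(2 * Real.pi ^ 2 * t) * ‖ξ‖ ^ 2 - 2 * Real.pi * ⟪y, ξ⟫) : ℝ) : ℂ) * G ξ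

/-- The entire function `Φ(z) = ∫ e^{-2π²t|ξ|²} e^{2πi z·ξ} G(ξ) dξ`: the heat operator at time `t`
applied to the function with Fourier transform `G`, continued to complex arguments. -/
noncomputable def heatTransform (t : ℝ) (G : RSpace d → ℂ) (z : CSpace d) : ℂ :=
  ∫ ξ, exp (((-(2 * Real.pi ^ 2 * t) * ‖ξ‖ ^ 2 : ℝ) : ℂ) + 2 * Real.pi * I * complexInner z ξ) * G ξ

lemma integrable_and_memLp_sliceDensity {t : ℝ} (ht : 0 < t) {G : RSpace d → ℂ} (hG : MemLp G 2)
    (y : RSpace d) : Integrable (sliceDensity t G y) ∧ MemLp (sliceDensity t G y) 2 := by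
  have hc : 0 < 2 * Real.pi ^ 2 * t := by positivity
  refine integrable_and_memLp_mul (c := 2 * Real.pi ^ 2 * t / 2)
    (A := Real.exp ((2 * Real.pi * ‖y‖) ^ 2 / (2 * (2 * Real.pi ^ 2 * t)))) hG ?_ (half_pos hc)
    fun ξ => ?_
  · exact (by fun_prop : Continuous fun ξ : RSpace d =>
      ((Real.exp (-(2 * Real.pi ^ 2 * t) * ‖ξ‖ ^ 2 - 2 * Real.pi * ⟪y, ξ⟫) : ℝ) :
        ℂ)).aestronglyMeasurable
  · rw [norm_real, Real.norm_eq_abs, abs_of_pos (Real.exp_pos _)]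
    refine le_trans (Real.exp_le_exp.2 ?_) (exp_neg_mul_sq_add_mul_le hc _ _)
    have h1 := (abs_le.1 (abs_real_inner_le_norm y ξ)).1
    have h2 := mul_le_mul_of_nonneg_left h1 (by positivity : 0 ≤ 2 * Real.pi)
    linarith

lemma heatTransform_complexPoint (t : ℝ) (G : RSpace d → ℂ) (x y : RSpace d) :
    heatTransform t G (complexPoint x y) = 𝓕⁻ (sliceDensity t G y) x := by
  rw [heatTransform, Real.fourierInv_eq']
  refine integral_congr_ae (Eventually.of_forall fun ξ => ?_)
  simp only [sliceDensity, complexInner_complexPoint, smul_eq_mul, ofReal_exp, ← mul_assoc,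
    ← exp_add]
  congr 2
  push_cast
  rw [real_inner_comm]
  linear_combination (2 * Real.pi * ⟪y, ξ⟫ : ℂ) * I_mul_I

/-- The linear form `z ↦ z·ξ` on `ℂ^d`. -/
noncomputable def complexInnerCLM (ξ : RSpace d) : CSpace d →L[ℂ] ℂ :=
  innerSL ℂ (WithLp.toLp 2 fun j => (ξ j : ℂ) : CSpace d)

lemma complexInnerCLM_apply (ξ : RSpace d) (z : CSpace d) :
    complexInnerCLM ξ z = complexInner z ξ := by
  simp [complexInnerCLM, complexInner, PiLp.inner_apply]

lemma norm_complexInnerCLM (ξ : RSpace d) : ‖complexInnerCLM ξ‖ = ‖ξ‖ := by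
  rw [complexInnerCLM, innerSL_apply_norm, EuclideanSpace.norm_eq, EuclideanSpace.norm_eq]
  simp

lemma continuous_complexInnerCLM : Continuous (complexInnerCLM : RSpace d → CSpace d →L[ℂ] ℂ) :=
  (innerSL ℂ).continuous.comp (by fun_prop)

lemma norm_complexInner_le (z : CSpace d) (ξ : RSpace d) :
    ‖complexInner z ξ‖ ≤ ‖z‖ * ‖ξ‖ := by
  rw [← complexInnerCLM_apply, ← norm_complexInnerCLM, mul_comm]
  exact ContinuousLinearMap.le_opNorm _ _

theorem differentiable_heatTransform {t : ℝ} (ht : 0 < t) {G : RSpace d → ℂ} (hG : MemLp G 2) :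
    Differentiable ℂ (heatTransform t G) := by
  intro z₀
  have hc : 0 < 2 * Real.pi ^ 2 * t := by positivity
  set c := 2 * Real.pi ^ 2 * t
  set K : CSpace d → RSpace d → ℂ := fun z ξ =>
    exp (((-c * ‖ξ‖ ^ 2 : ℝ) : ℂ) + 2 * Real.pi * I * complexInner z ξ) with hK
  have hKc : ∀ z, Continuous (K z) := by
    intro z
    have h1 : Continuous fun ξ : RSpace d => complexInner z ξ := by
      unfold complexInner
      fun_prop
    fun_prop
  have hKb : ∀ z ξ, ‖K z ξ‖ ≤ Real.exp (-c * ‖ξ‖ ^ 2 + 2 * Real.pi * ‖z‖ * ‖ξ‖) := by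
    intro z ξ
    rw [hK, norm_exp, Real.exp_le_exp, add_re, ofReal_re]
    gcongr
    refine (re_le_norm _).trans ?_
    rw [norm_mul]
    have := norm_complexInner_le z ξ
    have h2 : ‖(2 * Real.pi * I : ℂ)‖ = 2 * Real.pi := by
      simp [abs_of_pos Real.pi_pos]
    rw [h2, mul_assoc (2 * Real.pi)]
    exact mul_le_mul_of_nonneg_left this (by positivity)
  set b := 2 * Real.pi * (‖z₀‖ + 1)
  set E : RSpace d → ℝ := fun ξ => 2 * Real.pi * Real.exp (-c * ‖ξ‖ ^ 2 + (b + 1) * ‖ξ‖)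
  have hbound : Integrable fun ξ => E ξ * ‖G ξ‖ := by
    have h := (integrable_and_memLp_mul (K := fun ξ => (E ξ : ℂ)) (c := c / 2)
      (A := 2 * Real.pi * Real.exp ((b + 1) ^ 2 / (2 * c))) hG
      (by fun_prop : Continuous fun ξ => (E ξ : ℂ)).aestronglyMeasurable (half_pos hc) ?_).1.norm
    · refine h.congr (Eventually.of_forall fun ξ => ?_)
      simp only
      rw [norm_mul, norm_real, Real.norm_eq_abs, abs_of_nonneg (by positivity)]
    · intro ξ
      rw [norm_real, Real.norm_eq_abs, abs_of_nonneg (by positivity), mul_assoc]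
      exact mul_le_mul_of_nonneg_left (exp_neg_mul_sq_add_mul_le hc _ _) (by positivity)
  refine (hasFDerivAt_integral_of_dominated_of_fderiv_le (𝕜 := ℂ)
    (F := fun z ξ => K z ξ * G ξ)
    (F' := fun z ξ => (K z ξ * G ξ) • ((2 * Real.pi * I : ℂ) • complexInnerCLM ξ))
    (bound := fun ξ => E ξ * ‖G ξ‖)
    (s := Metric.ball z₀ 1) (Metric.ball_mem_nhds _ one_pos) ?_ ?_ ?_ ?_ hbound
    ?_).differentiableAt
  · exact Eventually.of_forall fun z => (hKc z).aestronglyMeasurable.mul hG.1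
  · refine (integrable_and_memLp_mul (c := c / 2)
      (A := Real.exp ((2 * Real.pi * ‖z₀‖) ^ 2 / (2 * c))) hG (hKc z₀).aestronglyMeasurable
      (half_pos hc) fun ξ => ?_).1
    exact (hKb z₀ ξ).trans (exp_neg_mul_sq_add_mul_le hc _ _)
  · have hL : Continuous fun ξ : RSpace d => (2 * Real.pi * I : ℂ) • complexInnerCLM ξ :=
      continuous_complexInnerCLM.const_smul (2 * Real.pi * I : ℂ)
    exact ((hKc z₀).aestronglyMeasurable.mul hG.1).smul hL.aestronglyMeasurable
  · refine Eventually.of_forall fun ξ z hz => ?_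
    rw [mem_ball_iff_norm] at hz
    have hz' : ‖z‖ ≤ ‖z₀‖ + 1 := by
      have := norm_le_norm_add_norm_sub' z z₀
      linarith
    have h2 : ‖(2 * Real.pi * I : ℂ)‖ = 2 * Real.pi := by
      simp [abs_of_pos Real.pi_pos]
    rw [norm_smul, norm_smul, h2, norm_complexInnerCLM, norm_mul]
    have h3 : ‖ξ‖ ≤ Real.exp ‖ξ‖ := by linarith [Real.add_one_le_exp ‖ξ‖]
    calc ‖K z ξ‖ * ‖G ξ‖ * (2 * Real.pi * ‖ξ‖)
        ≤ Real.exp (-c * ‖ξ‖ ^ 2 + b * ‖ξ‖) * ‖G ξ‖ * (2 * Real.pi * Real.exp ‖ξ‖) := by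
          gcongr
          refine (hKb z ξ).trans (Real.exp_le_exp.2 ?_)
          have : 2 * Real.pi * ‖z‖ ≤ b := mul_le_mul_of_nonneg_left hz' (by positivity)
          gcongr
      _ = 2 * Real.pi * (Real.exp (-c * ‖ξ‖ ^ 2 + b * ‖ξ‖) * Real.exp ‖ξ‖) * ‖G ξ‖ := by ring
      _ = E ξ * ‖G ξ‖ := by
          rw [← Real.exp_add]
          simp only [E]
          congr 3
          ring
  · refine Eventually.of_forall fun ξ z _ => ?_
    have h1 : HasFDerivAt (fun z : CSpace d => complexInner z ξ) (complexInnerCLM ξ) z := by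
      simp only [← complexInnerCLM_apply]
      exact (complexInnerCLM ξ).hasFDerivAt
    have h2 := (((h1.const_mul (2 * Real.pi * I : ℂ)).const_add
      ((-c * ‖ξ‖ ^ 2 : ℝ) : ℂ)).cexp).mul_const (G ξ)
    refine h2.congr_fderiv ?_
    simp only [hK, smul_smul]
    congr 1
    ring

/-! ### The heat operator in terms of the Fourier transform -/

lemma heatKernel_eq (t : ℝ) (x : RSpace d) :
    (heatKernel t x : ℂ) = (((2 * Real.pi * t) ^ (-(d : ℝ) / 2) : ℝ) : ℂ) *
      exp (-((1 / (2 * t) : ℝ) : ℂ) * ‖x‖ ^ 2) := by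
  rw [heatKernel]
  push_cast
  congr 2
  ring

lemma fourier_heatKernel {t : ℝ} (ht : 0 < t) (ξ : RSpace d) :
    𝓕 (fun x : RSpace d => (heatKernel t x : ℂ)) ξ =
      exp ((-(2 * Real.pi ^ 2 * t) * ‖ξ‖ ^ 2 : ℝ) : ℂ) := by
  have hb : 0 < ((1 / (2 * t) : ℝ) : ℂ).re := by
    rw [ofReal_re]
    positivity
  have h := fourier_gaussian_innerProductSpace hb ξ
  have hpt : 0 < 2 * Real.pi * t := by positivity
  have hfun : (fun x : RSpace d => (heatKernel t x : ℂ)) =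
      (((2 * Real.pi * t) ^ (-(d : ℝ) / 2) : ℝ) : ℂ) •
        fun x : RSpace d => exp (-((1 / (2 * t) : ℝ) : ℂ) * ‖x‖ ^ 2) := by
    funext x
    rw [heatKernel_eq]
    rfl
  have hsm : 𝓕 ((((2 * Real.pi * t) ^ (-(d : ℝ) / 2) : ℝ) : ℂ) •
        fun x : RSpace d => exp (-((1 / (2 * t) : ℝ) : ℂ) * ‖x‖ ^ 2)) ξ =
      (((2 * Real.pi * t) ^ (-(d : ℝ) / 2) : ℝ) : ℂ) *
        𝓕 (fun x : RSpace d => exp (-((1 / (2 * t) : ℝ) : ℂ) * ‖x‖ ^ 2)) ξ := by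
    simp only [Real.fourier_eq', Pi.smul_apply, smul_eq_mul]
    rw [← integral_const_mul]
    refine integral_congr_ae (Eventually.of_forall fun x => ?_)
    simp only
    ring
  rw [hfun, hsm, h, finrank_euclideanSpace_fin]
  have h1 : (Real.pi / ((1 / (2 * t) : ℝ) : ℂ)) ^ ((d : ℂ) / 2) =
      (((2 * Real.pi * t) ^ ((d : ℝ) / 2) : ℝ) : ℂ) := by
    rw [ofReal_cpow hpt.le]
    congr 1
    · push_cast
      field_simp
    · push_cast
      rfl
  rw [h1, ← mul_assoc, ← ofReal_mul, ← Real.rpow_add hpt, neg_div, neg_add_cancel, Real.rpow_zero,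
    ofReal_one, one_mul]
  congr 1
  have : (t : ℂ) ≠ 0 := by exact_mod_cast ht.ne'
  push_cast
  field_simp

lemma integrable_and_memLp_heatKernel_sub {t : ℝ} (ht : 0 < t) (x : RSpace d) :
    Integrable (fun x' : RSpace d => (heatKernel t (x - x') : ℂ)) ∧
      MemLp (fun x' : RSpace d => (heatKernel t (x - x') : ℂ)) 2 := by
  have hk : (heatKernel t : RSpace d → ℝ) = fun x => (2 * Real.pi * t) ^ (-(d : ℝ) / 2) *
      Real.exp (-(1 / (2 * t)) * ‖x‖ ^ 2) := by
    funext x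
    rw [heatKernel]
    congr 2
    ring
  have hb : 0 < 1 / (2 * t) := by positivity
  constructor
  · have h : Integrable (heatKernel t : RSpace d → ℝ) := by
      rw [hk]
      exact (integrable_exp_neg_mul_norm_sq hb).const_mul _
    exact (h.comp_sub_left x).ofReal
  · have h : MemLp (heatKernel t : RSpace d → ℝ) 2 := by
      rw [hk]
      exact (memLp_exp_neg_mul_norm_sq hb).const_mul _
    exact (h.comp_measurePreserving (Measure.measurePreserving_sub_left volume x)).ofReal

lemma fourier_heatKernel_sub {t : ℝ} (ht : 0 < t) (x ξ : RSpace d) :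
    𝓕 (fun x' : RSpace d => (heatKernel t (x - x') : ℂ)) ξ =
      exp ((-(2 * Real.pi * ⟪x, ξ⟫) : ℝ) * I) *
        exp ((-(2 * Real.pi ^ 2 * t) * ‖ξ‖ ^ 2 : ℝ) : ℂ) := by
  rw [← fourier_heatKernel ht, Real.fourier_eq', Real.fourier_eq',
    ← integral_sub_right_eq_self _ (-x), ← integral_const_mul]
  refine integral_congr_ae (Eventually.of_forall fun v => ?_)
  have hv : (heatKernel t (x - (v - -x)) : ℂ) = heatKernel t v := by
    simp [heatKernel]
  simp only [hv, smul_eq_mul]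
  rw [← mul_assoc, ← exp_add]
  congr 2
  rw [sub_neg_eq_add, inner_add_left]
  push_cast
  ring

/-- The heat operator is the restriction of the heat transform to the real points. -/
theorem heatOperator_eq_heatTransform {t : ℝ} (ht : 0 < t) (f : L2Space d) (x : RSpace d) :
    heatOperator t f x = heatTransform t (𝓕 f : L2Space d) (complexPoint x 0) := by
  have hk := integrable_and_memLp_heatKernel_sub ht x
  have h := integral_conj_mul_eq_fourier hk.1 hk.2 f
  simp only [conj_ofReal] at h
  rw [heatOperator, h, heatTransform]
  refine integral_congr_ae (Eventually.of_forall fun ξ => ?_)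
  simp only [fourier_heatKernel_sub ht, map_mul, ← exp_conj, conj_ofReal, conj_I,
    complexInner_complexPoint, inner_zero_left, ofReal_zero, mul_zero, add_zero]
  rw [← exp_add]
  congr 2
  push_cast
  ring

/-! ### Weighted estimates on the Fourier side -/

/-- Peetre's inequality for the weights `1 + |a|^m`. -/
lemma one_add_norm_add_pow_le {E : Type*} [SeminormedAddCommGroup E] (a b : E) (m : ℕ) :
    1 + ‖a + b‖ ^ m ≤ 2 ^ m * ((1 + ‖a‖ ^ m) * (1 + ‖b‖ ^ m)) := by
  have ha := norm_nonneg a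
  have hb := norm_nonneg b
  have h1 : ‖a + b‖ ^ m ≤ 2 ^ m * (‖a‖ ^ m + ‖b‖ ^ m) := by
    calc ‖a + b‖ ^ m ≤ (2 * max ‖a‖ ‖b‖) ^ m := by
          gcongr
          refine (norm_add_le _ _).trans ?_
          linarith [le_max_left ‖a‖ ‖b‖, le_max_right ‖a‖ ‖b‖]
      _ = 2 ^ m * max ‖a‖ ‖b‖ ^ m := mul_pow _ _ _
      _ ≤ _ := by
          gcongr
          rcases max_choice ‖a‖ ‖b‖ with h | h <;> rw [h]
          · linarith [pow_nonneg hb m]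
          · linarith [pow_nonneg ha m]
  have h2 : (1 : ℝ) ≤ 2 ^ m := one_le_pow₀ one_le_two
  have h3 : 0 ≤ ‖a‖ ^ m * ‖b‖ ^ m := by positivity
  nlinarith [mul_nonneg (by positivity : (0 : ℝ) ≤ 2 ^ m) h3]

lemma integrable_exp_mul_one_add_norm_pow {b : ℝ} (hb : 0 < b) (m : ℕ) :
    Integrable fun x : RSpace d => Real.exp (-b * ‖x‖ ^ 2) * (1 + ‖x‖ ^ m) := by
  refine ((integrable_exp_neg_mul_norm_sq (d := d) (half_pos hb)).const_mul
    (Real.exp (1 ^ 2 / (2 * b)) * (1 + m.factorial))).mono' (by fun_prop)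
    (Eventually.of_forall fun x => ?_)
  rw [Real.norm_eq_abs, abs_of_nonneg (by positivity)]
  have h1 : ‖x‖ ^ m ≤ m.factorial * Real.exp ‖x‖ := by
    have := Real.pow_div_factorial_le_exp ‖x‖ (norm_nonneg x) m
    rwa [div_le_iff₀' (by positivity)] at this
  have h2 : 1 ≤ Real.exp ‖x‖ := Real.one_le_exp (norm_nonneg x)
  calc Real.exp (-b * ‖x‖ ^ 2) * (1 + ‖x‖ ^ m)
      ≤ Real.exp (-b * ‖x‖ ^ 2) * ((1 + m.factorial) * Real.exp ‖x‖) := by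
        gcongr
        linarith
    _ = (1 + m.factorial) * Real.exp (-b * ‖x‖ ^ 2 + 1 * ‖x‖) := by
        rw [one_mul, Real.exp_add]
        ring
    _ ≤ (1 + m.factorial) *
        (Real.exp (1 ^ 2 / (2 * b)) * Real.exp (-(b / 2) * ‖x‖ ^ 2)) := by
        gcongr
        exact exp_neg_mul_sq_add_mul_le hb 1 _
    _ = _ := by ring

/-- The weight `e^{-|y|²/t} (1 + |y|^{2n})` in the imaginary direction. -/
noncomputable def imWeight (t : ℝ) (n : ℕ) (y : RSpace d) : ℝ :=
  Real.exp (-‖y‖ ^ 2 / t) * (1 + ‖y‖ ^ (2 * n))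

lemma imWeight_pos (t : ℝ) (n : ℕ) (y : RSpace d) : 0 < imWeight t n y := by
  unfold imWeight
  positivity

lemma continuous_imWeight (t : ℝ) (n : ℕ) :
    Continuous (imWeight t n : RSpace d → ℝ) := by
  unfold imWeight
  fun_prop

/-- The kernel `e^{-|y + 2πtξ|²/t} (1 + |y|^{2n})` between the imaginary part `y` and the frequency
`ξ`. -/
noncomputable def peakKernel (t : ℝ) (n : ℕ) (y ξ : RSpace d) : ℝ :=
  Real.exp (-‖y + (2 * Real.pi * t) • ξ‖ ^ 2 / t) * (1 + ‖y‖ ^ (2 * n))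

lemma measurable_peakKernel (t : ℝ) (n : ℕ) :
    Measurable fun p : RSpace d × RSpace d => peakKernel t n p.1 p.2 := by
  unfold peakKernel
  fun_prop

/-- The multiplier `J(ξ) = ∫ e^{-|y + 2πtξ|²/t} (1 + |y|^{2n}) dy` through which the weighted `L²`
norm of the heat transform is expressed on the Fourier side. -/
noncomputable def fourierWeight (t : ℝ) (n : ℕ) (ξ : RSpace d) : ℝ≥0∞ :=
  ∫⁻ y : RSpace d, ENNReal.ofReal (peakKernel t n y ξ)

lemma fourierWeight_eq (t : ℝ) (n : ℕ) (ξ : RSpace d) :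
    fourierWeight t n ξ = ∫⁻ u : RSpace d, ENNReal.ofReal
      (Real.exp (-‖u‖ ^ 2 / t) * (1 + ‖u - (2 * Real.pi * t) • ξ‖ ^ (2 * n))) := by
  rw [fourierWeight, ← lintegral_sub_right_eq_self _ ((2 * Real.pi * t) • ξ)]
  simp only [peakKernel, sub_add_cancel]

/-- Completing the square: the imaginary weight times the squared modulus of the slice density is
a Gaussian centred at `-2πtξ`. -/
lemma imWeight_mul_enorm_sliceDensity_sq {t : ℝ} (ht : 0 < t) (n : ℕ) (G : RSpace d → ℂ)
    (y ξ : RSpace d) :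
    ENNReal.ofReal (imWeight t n y) * ‖sliceDensity t G y ξ‖ₑ ^ 2 =
      ENNReal.ofReal (peakKernel t n y ξ) * ‖G ξ‖ₑ ^ 2 := by
  rw [sliceDensity, enorm_mul, mul_pow, ← mul_assoc]
  congr 1
  rw [← ofReal_norm, norm_real, Real.norm_eq_abs, abs_of_pos (Real.exp_pos _),
    ← ENNReal.ofReal_pow (Real.exp_pos _).le, ← ENNReal.ofReal_mul (imWeight_pos t n y).le,
    imWeight, peakKernel, mul_right_comm, ← Real.exp_nat_mul, ← Real.exp_add]
  congr 3
  rw [norm_add_sq_real, norm_smul, real_inner_smul_right, Real.norm_eq_abs, mul_pow, sq_abs]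
  push_cast
  field_simp
  ring

/-- The weighted norm in the imaginary direction, computed on the Fourier side. -/
lemma lintegral_imWeight_mul_sliceDensity {t : ℝ} (ht : 0 < t) (n : ℕ) {G : RSpace d → ℂ}
    (hG : AEStronglyMeasurable G volume) :
    ∫⁻ y : RSpace d, ENNReal.ofReal (imWeight t n y) * ∫⁻ ξ, ‖sliceDensity t G y ξ‖ₑ ^ 2 =
      ∫⁻ ξ, fourierWeight t n ξ * ‖G ξ‖ₑ ^ 2 := by
  have hm := (measurable_peakKernel (d := d) t n).ennreal_ofReal
  have hG2 : AEMeasurable (fun p : RSpace d × RSpace d => ‖G p.2‖ₑ ^ 2)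
      (volume.prod volume) := (hG.enorm.pow_const 2).comp_snd
  have hp : AEMeasurable (fun p : RSpace d × RSpace d =>
      ENNReal.ofReal (peakKernel t n p.1 p.2) * ‖G p.2‖ₑ ^ 2) (volume.prod volume) :=
    hm.aemeasurable.mul hG2
  have h1 : ∀ y : RSpace d, ENNReal.ofReal (imWeight t n y) *
      ∫⁻ ξ, ‖sliceDensity t G y ξ‖ₑ ^ 2 =
        ∫⁻ ξ, ENNReal.ofReal (peakKernel t n y ξ) * ‖G ξ‖ₑ ^ 2 := by
    intro y
    rw [← lintegral_const_mul' _ _ ENNReal.ofReal_ne_top]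
    exact lintegral_congr fun ξ => imWeight_mul_enorm_sliceDensity_sq ht n G y ξ
  have h2 : ∀ ξ : RSpace d, ∫⁻ y, ENNReal.ofReal (peakKernel t n y ξ) * ‖G ξ‖ₑ ^ 2 =
      fourierWeight t n ξ * ‖G ξ‖ₑ ^ 2 := by
    intro ξ
    have hmξ : Measurable fun y => ENNReal.ofReal (peakKernel t n y ξ) := by
      unfold peakKernel
      fun_prop
    rw [lintegral_mul_const _ hmξ, fourierWeight]
  rw [lintegral_congr h1, lintegral_lintegral_swap hp, lintegral_congr h2]

lemma one_add_mul_pow_le {c r : ℝ} (hc : 0 ≤ c) (hr : 0 ≤ r) (m : ℕ) :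
    1 + (c * r) ^ m ≤ (1 + c ^ m) * (1 + r ^ m) := by
  rw [mul_pow]
  have h1 := pow_nonneg hc m
  have h2 := pow_nonneg hr m
  nlinarith

lemma norm_two_pi_smul {t : ℝ} (ht : 0 < t) (ξ : RSpace d) :
    ‖(2 * Real.pi * t) • ξ‖ = 2 * Real.pi * t * ‖ξ‖ := by
  rw [norm_smul, Real.norm_eq_abs, abs_of_pos (by positivity)]

lemma exists_fourierWeight_le {t : ℝ} (ht : 0 < t) (n : ℕ) :
    ∃ C : ℝ≥0∞, C ≠ ⊤ ∧ ∀ ξ : RSpace d,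
      fourierWeight t n ξ ≤ C * ENNReal.ofReal (1 + ‖ξ‖ ^ (2 * n)) := by
  have hint := integrable_exp_mul_one_add_norm_pow (d := d) (b := 1 / t) (by positivity) (2 * n)
  set A := ∫⁻ u : RSpace d, ENNReal.ofReal (Real.exp (-(1 / t) * ‖u‖ ^ 2) * (1 + ‖u‖ ^ (2 * n)))
  have hA : A ≠ ⊤ := by
    have h := hint.2
    rw [hasFiniteIntegral_iff_ofReal (Eventually.of_forall fun u => by positivity)] at h
    exact h.ne
  set B : ℝ := 2 ^ (2 * n) * (1 + (2 * Real.pi * t) ^ (2 * n))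
  refine ⟨A * ENNReal.ofReal B, ENNReal.mul_ne_top hA ENNReal.ofReal_ne_top, fun ξ => ?_⟩
  rw [fourierWeight_eq, mul_assoc A, ← ENNReal.ofReal_mul (by positivity),
    ← lintegral_mul_const' _ _ ENNReal.ofReal_ne_top]
  refine lintegral_mono fun u => ?_
  rw [← ENNReal.ofReal_mul (by positivity)]
  refine ENNReal.ofReal_le_ofReal ?_
  have h1 := one_add_norm_add_pow_le u (-((2 * Real.pi * t) • ξ)) (2 * n)
  rw [← sub_eq_add_neg, norm_neg, norm_two_pi_smul ht] at h1
  have h2 := one_add_mul_pow_le (by positivity : 0 ≤ 2 * Real.pi * t) (norm_nonneg ξ) (2 * n)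
  have h3 : -‖u‖ ^ 2 / t = -(1 / t) * ‖u‖ ^ 2 := by ring
  rw [h3]
  calc Real.exp (-(1 / t) * ‖u‖ ^ 2) * (1 + ‖u - (2 * Real.pi * t) • ξ‖ ^ (2 * n))
      ≤ Real.exp (-(1 / t) * ‖u‖ ^ 2) * (2 ^ (2 * n) * ((1 + ‖u‖ ^ (2 * n)) *
        ((1 + (2 * Real.pi * t) ^ (2 * n)) * (1 + ‖ξ‖ ^ (2 * n))))) := by
        gcongr
        exact h1.trans (by gcongr)
    _ = _ := by
        simp only [B]
        ring

lemma exists_le_fourierWeight {t : ℝ} (ht : 0 < t) (n : ℕ) :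
    ∃ C : ℝ≥0∞, C ≠ ⊤ ∧ ∀ ξ : RSpace d,
      ENNReal.ofReal (1 + ‖ξ‖ ^ (2 * n)) ≤ C * fourierWeight t n ξ := by
  set k : RSpace d → ℝ≥0∞ := fun u =>
    ENNReal.ofReal (Real.exp (-‖u‖ ^ 2 / t) * (1 + ‖u‖ ^ (2 * n))⁻¹) with hk
  have hpos : ∀ u : RSpace d, 0 < 1 + ‖u‖ ^ (2 * n) := fun u => by positivity
  have hkm : Measurable k := by
    have : Continuous fun u : RSpace d => Real.exp (-‖u‖ ^ 2 / t) * (1 + ‖u‖ ^ (2 * n))⁻¹ :=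
      (by fun_prop : Continuous fun u : RSpace d => Real.exp (-‖u‖ ^ 2 / t)).mul
        ((by fun_prop : Continuous fun u : RSpace d => 1 + ‖u‖ ^ (2 * n)).inv₀
          fun u => (hpos u).ne')
    exact this.measurable.ennreal_ofReal
  set κ := ∫⁻ u, k u
  have hκ : κ ≠ 0 := by
    intro h
    rw [lintegral_eq_zero_iff hkm] at h
    obtain ⟨u, hu⟩ := h.exists
    simp only [hk, Pi.zero_apply, ENNReal.ofReal_eq_zero] at hu
    have h1 := hpos u
    have : 0 < Real.exp (-‖u‖ ^ 2 / t) * (1 + ‖u‖ ^ (2 * n))⁻¹ := by positivity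
    linarith
  set c := (2 * Real.pi * t)⁻¹
  set B : ℝ := (1 + c ^ (2 * n)) * 2 ^ (2 * n)
  refine ⟨κ⁻¹ * ENNReal.ofReal B, ENNReal.mul_ne_top (ENNReal.inv_ne_top.2 hκ)
    ENNReal.ofReal_ne_top, fun ξ => ?_⟩
  have hmain : κ * ENNReal.ofReal (1 + ‖ξ‖ ^ (2 * n)) ≤
      ENNReal.ofReal B * fourierWeight t n ξ := by
    rw [fourierWeight_eq, ← lintegral_mul_const' _ _ ENNReal.ofReal_ne_top,
      ← lintegral_const_mul' _ _ ENNReal.ofReal_ne_top]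
    refine lintegral_mono fun u => ?_
    simp only [hk]
    rw [← ENNReal.ofReal_mul (by positivity), ← ENNReal.ofReal_mul (by positivity)]
    refine ENNReal.ofReal_le_ofReal ?_
    have h1 := one_add_norm_add_pow_le u (-(u - (2 * Real.pi * t) • ξ)) (2 * n)
    rw [norm_neg, ← sub_eq_add_neg, sub_sub_cancel, norm_two_pi_smul ht] at h1
    have h2 := one_add_mul_pow_le (by positivity : 0 ≤ c)
      (by positivity : 0 ≤ 2 * Real.pi * t * ‖ξ‖) (2 * n)
    have h3 : c * (2 * Real.pi * t * ‖ξ‖) = ‖ξ‖ := by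
      simp only [c]
      field_simp
    rw [h3] at h2
    have h4 := hpos u
    calc Real.exp (-‖u‖ ^ 2 / t) * (1 + ‖u‖ ^ (2 * n))⁻¹ * (1 + ‖ξ‖ ^ (2 * n))
        ≤ Real.exp (-‖u‖ ^ 2 / t) * (1 + ‖u‖ ^ (2 * n))⁻¹ * ((1 + c ^ (2 * n)) *
          (2 ^ (2 * n) * ((1 + ‖u‖ ^ (2 * n)) *
            (1 + ‖u - (2 * Real.pi * t) • ξ‖ ^ (2 * n))))) := by
          gcongr
          exact h2.trans (by gcongr)
      _ = _ := by
          simp only [B]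
          field_simp
  by_cases hκt : κ = ⊤
  · exfalso
    have hint := integrable_exp_mul_one_add_norm_pow (d := d) (b := 1 / t) (by positivity) (2 * n)
    have h := hint.2
    rw [hasFiniteIntegral_iff_ofReal (Eventually.of_forall fun u => by positivity)] at h
    refine (lt_of_le_of_lt (lintegral_mono fun u => ?_) h).ne hκt
    refine ENNReal.ofReal_le_ofReal ?_
    have h3 : -‖u‖ ^ 2 / t = -(1 / t) * ‖u‖ ^ 2 := by ring
    have h4 : (1 : ℝ) ≤ 1 + ‖u‖ ^ (2 * n) := by linarith [pow_nonneg (norm_nonneg u) (2 * n)]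
    rw [h3]
    gcongr
    exact (inv_le_one_of_one_le₀ h4).trans h4
  · rw [mul_assoc, ← ENNReal.div_eq_inv_mul, ENNReal.le_div_iff_mul_le (Or.inl hκ) (Or.inl hκt),
      mul_comm]
    exact hmain

/-- Finiteness of the weighted norm in terms of the spectrum: the polynomial weight in `y` turns
into the Sobolev weight in `ξ`. -/
theorem lintegral_imWeight_lt_top_iff {t : ℝ} (ht : 0 < t) (n : ℕ) {G : RSpace d → ℂ}
    (hG : AEStronglyMeasurable G volume) :
    ∫⁻ y : RSpace d, ENNReal.ofReal (imWeight t n y) * ∫⁻ ξ, ‖sliceDensity t G y ξ‖ₑ ^ 2 < ⊤ ↔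
      ∫⁻ ξ, ‖G ξ‖ₑ ^ 2 * ENNReal.ofReal (1 + ‖ξ‖ ^ (2 * n)) < ⊤ := by
  rw [lintegral_imWeight_mul_sliceDensity ht n hG]
  constructor
  · intro h
    obtain ⟨C, hC, hle⟩ := exists_le_fourierWeight (d := d) ht n
    calc ∫⁻ ξ, ‖G ξ‖ₑ ^ 2 * ENNReal.ofReal (1 + ‖ξ‖ ^ (2 * n))
        ≤ ∫⁻ ξ, C * (fourierWeight t n ξ * ‖G ξ‖ₑ ^ 2) := by
          refine lintegral_mono fun ξ => ?_
          rw [← mul_assoc, mul_comm]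
          gcongr
          exact hle ξ
      _ = C * ∫⁻ ξ, fourierWeight t n ξ * ‖G ξ‖ₑ ^ 2 := lintegral_const_mul' _ _ hC
      _ < ⊤ := ENNReal.mul_lt_top hC.lt_top h
  · intro h
    obtain ⟨C, hC, hle⟩ := exists_fourierWeight_le (d := d) ht n
    calc ∫⁻ ξ, fourierWeight t n ξ * ‖G ξ‖ₑ ^ 2
        ≤ ∫⁻ ξ, C * (‖G ξ‖ₑ ^ 2 * ENNReal.ofReal (1 + ‖ξ‖ ^ (2 * n))) := by
          refine lintegral_mono fun ξ => ?_
          rw [mul_left_comm, mul_comm]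
          gcongr
          exact hle ξ
      _ = C * ∫⁻ ξ, ‖G ξ‖ₑ ^ 2 * ENNReal.ofReal (1 + ‖ξ‖ ^ (2 * n)) :=
          lintegral_const_mul' _ _ hC
      _ < ⊤ := ENNReal.mul_lt_top hC.lt_top h

/-- Weighted square integrability as an iterated integral over the slices `x ↦ Φ(x + iy)`. -/
lemma weightedSquareIntegrable_iff {t : ℝ} {n : ℕ} {Φ : CSpace d → ℂ} (hΦ : Continuous Φ) :
    WeightedSquareIntegrable t n Φ ↔
      ∫⁻ y : RSpace d, ENNReal.ofReal (imWeight t n y) *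
        ∫⁻ x, ‖Φ (complexPoint x y)‖ₑ ^ 2 < ⊤ := by
  have hc := continuous_complexPoint (d := d)
  have hΦc : Continuous fun p : RSpace d × RSpace d => Φ (complexPoint p.1 p.2) := hΦ.comp hc
  have hW : Continuous fun p : RSpace d × RSpace d =>
      ‖Φ (complexPoint p.1 p.2)‖ ^ 2 * Real.exp (-‖p.2‖ ^ 2 / t) * (1 + ‖p.2‖ ^ (2 * n)) := by
    fun_prop
  rw [WeightedSquareIntegrable, Integrable, and_iff_right hW.aestronglyMeasurable,
    hasFiniteIntegral_iff_ofReal (Eventually.of_forall fun p => by positivity),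
    Measure.volume_eq_prod, lintegral_prod_symm' _ hW.measurable.ennreal_ofReal]
  refine iff_of_eq (congrArg (· < ⊤) (lintegral_congr fun y => ?_))
  rw [← lintegral_const_mul' _ _ ENNReal.ofReal_ne_top]
  refine lintegral_congr fun x => ?_
  rw [← ofReal_norm, ← ENNReal.ofReal_pow (norm_nonneg _),
    ← ENNReal.ofReal_mul (imWeight_pos t n y).le, imWeight]
  congr 1
  ring

/-- The heat transform of a spectrum in the weighted `L²` space is weighted square integrable. -/
theorem weightedSquareIntegrable_heatTransform {t : ℝ} (ht : 0 < t) {n : ℕ} {G : RSpace d → ℂ}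
    (hG : MemLp G 2)
    (hGn : ∫⁻ ξ, ‖G ξ‖ₑ ^ 2 * ENNReal.ofReal (1 + ‖ξ‖ ^ (2 * n)) < ⊤) :
    WeightedSquareIntegrable t n (heatTransform t G) := by
  rw [weightedSquareIntegrable_iff (differentiable_heatTransform ht hG).continuous]
  rw [← lintegral_imWeight_lt_top_iff ht n hG.1] at hGn
  refine lt_of_eq_of_lt (lintegral_congr fun y => ?_) hGn
  have h := integrable_and_memLp_sliceDensity ht hG y
  rw [← lintegral_enorm_sq_fourierInv h.1 h.2]
  simp only [heatTransform_complexPoint]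

/-! ### The pointwise bound -/

lemma enorm_sliceDensity_eq {t : ℝ} (ht : 0 < t) (G : RSpace d → ℂ) (y ξ : RSpace d) :
    ‖sliceDensity t G y ξ‖ₑ = ENNReal.ofReal (Real.exp (‖y‖ ^ 2 / (2 * t)) *
      Real.exp (-(1 / (2 * t)) * ‖y + (2 * Real.pi * t) • ξ‖ ^ 2)) * ‖G ξ‖ₑ := by
  rw [sliceDensity, enorm_mul, ← ofReal_norm, norm_real, Real.norm_eq_abs,
    abs_of_pos (Real.exp_pos _), ← Real.exp_add]
  congr 3
  rw [norm_add_sq_real, norm_smul, real_inner_smul_right, Real.norm_eq_abs, mul_pow, sq_abs]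
  field_simp
  ring

/-- The pointwise bound for the heat transform of a spectrum in the weighted `L²` space: by
Peetre's inequality the weight `1 + |y|^n` is distributed onto the Gaussian centred at `-2πtξ` and
onto the spectrum, and both factors are square integrable in `ξ`, the first one with a norm that
does not depend on `y`. -/
theorem exists_norm_heatTransform_le {t : ℝ} (ht : 0 < t) {n : ℕ} {G : RSpace d → ℂ}
    (hGn : ∫⁻ ξ, ‖G ξ‖ₑ ^ 2 * ENNReal.ofReal (1 + ‖ξ‖ ^ (2 * n)) < ⊤) :
    ∃ C : ℝ, ∀ x y : RSpace d, ‖heatTransform t G (complexPoint x y)‖ ≤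
      C * (Real.exp (‖y‖ ^ 2 / (2 * t)) / (1 + ‖y‖ ^ n)) := by
  set c := 2 * Real.pi * t
  have hc : 0 < c := by positivity
  set q : RSpace d → ℝ := fun u => Real.exp (-(1 / (2 * t)) * ‖u‖ ^ 2) * (1 + ‖u‖ ^ n) with hq
  have hq0 : ∀ u, 0 ≤ q u := fun u => by positivity
  have hqm : Measurable fun u : RSpace d => ENNReal.ofReal (q u) := by
    fun_prop
  have hsq : ∀ r : ℝ, (1 + r ^ n) ^ 2 ≤ 2 * (1 + r ^ (2 * n)) := fun r => by
    rw [mul_comm 2 n, pow_mul]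
    nlinarith [sq_nonneg (1 - r ^ n)]
  set A := ∫⁻ ξ : RSpace d, ENNReal.ofReal (q (c • ξ)) ^ 2
  set D : ℝ := (1 + c ^ n) ^ 2 * 2
  set B := ENNReal.ofReal D * ∫⁻ ξ, ‖G ξ‖ₑ ^ 2 * ENNReal.ofReal (1 + ‖ξ‖ ^ (2 * n))
  have hA : A ≠ ⊤ := by
    have hint := ((integrable_exp_mul_one_add_norm_pow (d := d) (b := 1 / t) (by positivity)
      (2 * n)).const_mul 2).comp_smul hc.ne'
    have h := hint.2
    rw [hasFiniteIntegral_iff_ofReal (Eventually.of_forall fun u => by positivity)] at h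
    refine (lt_of_le_of_lt (lintegral_mono fun ξ => ?_) h).ne
    rw [← ENNReal.ofReal_pow (hq0 _)]
    refine ENNReal.ofReal_le_ofReal ?_
    simp only [hq]
    rw [mul_pow, ← Real.exp_nat_mul]
    have h1 : ((2 : ℕ) : ℝ) * (-(1 / (2 * t)) * ‖c • ξ‖ ^ 2) = -(1 / t) * ‖c • ξ‖ ^ 2 := by
      push_cast
      field_simp
    rw [h1]
    have h2 := mul_le_mul_of_nonneg_left (hsq ‖c • ξ‖)
      (Real.exp_pos (-(1 / t) * ‖c • ξ‖ ^ 2)).le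
    linarith
  have hB : B ≠ ⊤ := (ENNReal.mul_lt_top ENNReal.ofReal_lt_top hGn).ne
  refine ⟨2 ^ n * (A + B).toReal, fun x y => ?_⟩
  have hshift : ∫⁻ ξ : RSpace d, ENNReal.ofReal (q (y + c • ξ)) ^ 2 = A := by
    have h := lintegral_add_left_eq_self (μ := volume)
      (fun ξ => ENNReal.ofReal (q (c • ξ)) ^ 2) (c⁻¹ • y)
    simpa only [smul_add, smul_inv_smul₀ hc.ne'] using h
  have hpt : ∀ ξ, ENNReal.ofReal (1 + ‖y‖ ^ n) * ‖sliceDensity t G y ξ‖ₑ ≤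
      ENNReal.ofReal (2 ^ n * Real.exp (‖y‖ ^ 2 / (2 * t))) *
        (ENNReal.ofReal (q (y + c • ξ)) ^ 2 + ENNReal.ofReal D *
          (‖G ξ‖ₑ ^ 2 * ENNReal.ofReal (1 + ‖ξ‖ ^ (2 * n)))) := by
    intro ξ
    have hg := ofReal_norm (G ξ)
    rw [enorm_sliceDensity_eq ht, ← hg, ← ENNReal.ofReal_mul (by positivity),
      ← ENNReal.ofReal_mul (by positivity), ← ENNReal.ofReal_pow (norm_nonneg _),
      ← ENNReal.ofReal_pow (hq0 _), ← ENNReal.ofReal_mul (by positivity),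
      ← ENNReal.ofReal_mul (by positivity), ← ENNReal.ofReal_add (by positivity) (by positivity),
      ← ENNReal.ofReal_mul (by positivity)]
    refine ENNReal.ofReal_le_ofReal ?_
    have h1 := one_add_norm_add_pow_le (y + c • ξ) (-(c • ξ)) n
    rw [add_neg_cancel_right, norm_neg, norm_two_pi_smul ht] at h1
    have h2 := one_add_mul_pow_le hc.le (norm_nonneg ξ) n
    set E := Real.exp (‖y‖ ^ 2 / (2 * t))
    set e := Real.exp (-(1 / (2 * t)) * ‖y + c • ξ‖ ^ 2)
    set b := (1 + c ^ n) * (1 + ‖ξ‖ ^ n) * ‖G ξ‖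
    have h3 : b ^ 2 ≤ D * (‖G ξ‖ ^ 2 * (1 + ‖ξ‖ ^ (2 * n))) := by
      have := mul_le_mul_of_nonneg_left (hsq ‖ξ‖)
        (by positivity : 0 ≤ (1 + c ^ n) ^ 2 * ‖G ξ‖ ^ 2)
      simp only [b, D]
      linarith
    have h4 : q (y + c • ξ) * b ≤ q (y + c • ξ) ^ 2 + b ^ 2 := by
      nlinarith [sq_nonneg (q (y + c • ξ) - b), sq_nonneg (q (y + c • ξ)), sq_nonneg b]
    calc (1 + ‖y‖ ^ n) * (E * e * ‖G ξ‖)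
        ≤ 2 ^ n * ((1 + ‖y + c • ξ‖ ^ n) * ((1 + c ^ n) * (1 + ‖ξ‖ ^ n))) *
            (E * e * ‖G ξ‖) := by
          gcongr
          exact h1.trans (by gcongr)
      _ = 2 ^ n * E * (q (y + c • ξ) * b) := by
          simp only [hq, b, e]
          ring
      _ ≤ 2 ^ n * E * (q (y + c • ξ) ^ 2 + D * (‖G ξ‖ ^ 2 * (1 + ‖ξ‖ ^ (2 * n)))) := by
          gcongr
          linarith
  have hmain : ENNReal.ofReal (1 + ‖y‖ ^ n) * ‖heatTransform t G (complexPoint x y)‖ₑ ≤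
      ENNReal.ofReal (2 ^ n * Real.exp (‖y‖ ^ 2 / (2 * t))) * (A + B) := by
    calc ENNReal.ofReal (1 + ‖y‖ ^ n) * ‖heatTransform t G (complexPoint x y)‖ₑ
        ≤ ENNReal.ofReal (1 + ‖y‖ ^ n) * ∫⁻ ξ, ‖sliceDensity t G y ξ‖ₑ := by
          gcongr
          rw [heatTransform_complexPoint, Real.fourierInv_eq']
          refine (enorm_integral_le_lintegral_enorm _).trans_eq (lintegral_congr fun ξ => ?_)
          rw [enorm_smul, ← ofReal_norm, norm_exp_ofReal_mul_I, ENNReal.ofReal_one, one_mul]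
      _ = ∫⁻ ξ, ENNReal.ofReal (1 + ‖y‖ ^ n) * ‖sliceDensity t G y ξ‖ₑ :=
          (lintegral_const_mul' _ _ ENNReal.ofReal_ne_top).symm
      _ ≤ _ := lintegral_mono hpt
      _ = ENNReal.ofReal (2 ^ n * Real.exp (‖y‖ ^ 2 / (2 * t))) * (A + B) := by
          have hm : Measurable fun ξ : RSpace d => ENNReal.ofReal (q (y + c • ξ)) ^ 2 :=
            (hqm.comp (by fun_prop : Measurable fun ξ : RSpace d => y + c • ξ)).pow_const 2
          rw [lintegral_const_mul' _ _ ENNReal.ofReal_ne_top, lintegral_add_left hm,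
            lintegral_const_mul' _ _ ENNReal.ofReal_ne_top, hshift]
  have h := ENNReal.toReal_mono (ENNReal.mul_ne_top ENNReal.ofReal_ne_top
    (ENNReal.add_ne_top.2 ⟨hA, hB⟩)) hmain
  rw [ENNReal.toReal_mul, ENNReal.toReal_mul, ENNReal.toReal_ofReal (by positivity),
    ENNReal.toReal_ofReal (by positivity), toReal_enorm] at h
  rw [← mul_div_assoc, le_div_iff₀ (by positivity)]
  linarith

/-! ### The spectrum of a weighted square integrable entire function -/

lemma continuous_slice {Φ : CSpace d → ℂ} (hΦ : Continuous Φ) (y : RSpace d) :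
    Continuous fun x => Φ (complexPoint x y) :=
  hΦ.comp ((continuous_complexPoint (d := d)).comp
    (by fun_prop : Continuous fun x : RSpace d => (x, y)))

lemma integrable_gaussianSlice {Φ : CSpace d → ℂ} (hΦ : Continuous Φ) {y : RSpace d} {M ε : ℝ}
    (hb : ∀ x, ‖Φ (complexPoint x y)‖ ≤ M) (hε : 0 < ε) : Integrable (gaussianSlice ε Φ y) := by
  refine ((integrable_exp_neg_mul_norm_sq (d := d) hε).const_mul
    (M * Real.exp (ε * ‖y‖ ^ 2))).mono' (continuous_gaussianSlice ε hΦ y).aestronglyMeasurable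
    (Eventually.of_forall fun x => ?_)
  rw [norm_gaussianSlice, mul_assoc]
  gcongr
  exact hb x

lemma norm_gaussianSlice_le (Φ : CSpace d → ℂ) {ε : ℝ} (hε : 0 ≤ ε) (hε1 : ε ≤ 1)
    (y x : RSpace d) :
    ‖gaussianSlice ε Φ y x‖ ≤ Real.exp (‖y‖ ^ 2) * ‖Φ (complexPoint x y)‖ := by
  rw [norm_gaussianSlice, mul_comm]
  gcongr
  rw [← Real.exp_add, Real.exp_le_exp]
  nlinarith [sq_nonneg ‖x‖, sq_nonneg ‖y‖, mul_nonneg hε (sq_nonneg ‖x‖)]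

lemma tendsto_gaussianSlice (Φ : CSpace d → ℂ) (y x : RSpace d) {ε : ℕ → ℝ}
    (hε : Tendsto ε atTop (𝓝 0)) :
    Tendsto (fun k => gaussianSlice (ε k) Φ y x) atTop (𝓝 (Φ (complexPoint x y))) := by
  have hc : Continuous fun r : ℝ =>
      Φ (complexPoint x y) * exp (-(r : ℂ) * complexNormSq (complexPoint x y)) := by fun_prop
  have h := (hc.tendsto 0).comp hε
  simpa [Function.comp_def, gaussianSlice] using h

/-- As the regularization is removed, the Fourier transforms of the regularized slices converge
almost everywhere, along a subsequence, to the `L²` Fourier transform of the slice. -/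
lemma exists_tendsto_fourier_gaussianSlice {Φ : CSpace d → ℂ} (hΦ : Continuous Φ) {y : RSpace d}
    {M : ℝ} (hb : ∀ x, ‖Φ (complexPoint x y)‖ ≤ M)
    (h2 : MemLp (fun x => Φ (complexPoint x y)) 2) {ε : ℕ → ℝ} (hε0 : ∀ k, 0 < ε k)
    (hε1 : ∀ k, ε k ≤ 1) (hε : Tendsto ε atTop (𝓝 0)) :
    ∃ ψ : ℕ → ℕ, StrictMono ψ ∧ ∀ᵐ ξ, Tendsto (fun k => 𝓕 (gaussianSlice (ε (ψ k)) Φ y) ξ) atTop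
      (𝓝 ((𝓕 (h2.toLp _) : L2Space d) ξ)) := by
  have hv2 : ∀ k, MemLp (gaussianSlice (ε k) Φ y) 2 := fun k =>
    (h2.norm.const_mul (Real.exp (‖y‖ ^ 2))).mono
      (continuous_gaussianSlice _ hΦ y).aestronglyMeasurable (Eventually.of_forall fun x =>
        (norm_gaussianSlice_le Φ (hε0 k).le (hε1 k) y x).trans (le_abs_self _))
  have hvi : ∀ k, Integrable (gaussianSlice (ε k) Φ y) := fun k =>
    integrable_gaussianSlice hΦ hb (hε0 k)
  set A : ℝ := Real.exp (‖y‖ ^ 2) + 1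
  have hint : Tendsto
      (fun k => ∫⁻ x, ‖gaussianSlice (ε k) Φ y x - Φ (complexPoint x y)‖ₑ ^ 2) atTop (𝓝 0) := by
    have hdom : ∫⁻ x, (ENNReal.ofReal A * ‖Φ (complexPoint x y)‖ₑ) ^ 2 ≠ ⊤ := by
      simp only [mul_pow]
      rw [lintegral_const_mul' _ _ (ENNReal.pow_ne_top ENNReal.ofReal_ne_top)]
      exact ENNReal.mul_ne_top (ENNReal.pow_ne_top ENNReal.ofReal_ne_top)
        ((memLp_two_iff_lintegral h2.1).1 h2).ne
    have h := tendsto_lintegral_of_dominated_convergence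
      (F := fun k x => ‖gaussianSlice (ε k) Φ y x - Φ (complexPoint x y)‖ₑ ^ 2)
      (f := fun _ => (0 : ℝ≥0∞)) (μ := (volume : Measure (RSpace d))) _ (fun k => ?_)
      (fun k => Eventually.of_forall fun x => ?_) hdom (Eventually.of_forall fun x => ?_)
    · simpa using h
    · exact ((continuous_gaussianSlice _ hΦ y).sub
        (continuous_slice hΦ y)).measurable.enorm.pow_const 2
    · dsimp only
      gcongr
      rw [← ofReal_norm, ← ofReal_norm, ← ENNReal.ofReal_mul (by positivity)]
      refine ENNReal.ofReal_le_ofReal ((norm_sub_le _ _).trans ?_)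
      have := norm_gaussianSlice_le Φ (hε0 k).le (hε1 k) y x
      simp only [A]
      linarith
    · have h := (tendsto_gaussianSlice Φ y x hε).sub_const (Φ (complexPoint x y))
      rw [sub_self] at h
      have h' := ENNReal.Tendsto.pow (n := 2) h.enorm
      simpa using h'
  have hLp : Tendsto (fun k => (hv2 k).toLp _) atTop (𝓝 (h2.toLp _)) := by
    rw [Lp.tendsto_Lp_iff_tendsto_eLpNorm'']
    have h : Tendsto (fun k => (∫⁻ x,
        ‖gaussianSlice (ε k) Φ y x - Φ (complexPoint x y)‖ₑ ^ 2) ^ (1 / 2 : ℝ)) atTop (𝓝 0) := by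
      have := (ENNReal.continuous_rpow_const (y := 1 / 2)).tendsto 0 |>.comp hint
      simpa [Function.comp_def] using this
    refine h.congr fun k => ?_
    have hsq := eLpNorm_two_sq (μ := (volume : Measure (RSpace d)))
      (gaussianSlice (ε k) Φ y - fun x => Φ (complexPoint x y))
    simp only [Pi.sub_apply] at hsq
    rw [← hsq, ← ENNReal.rpow_natCast, ← ENNReal.rpow_mul]
    simp
  have hF : Tendsto (fun k => (𝓕 ((hv2 k).toLp _) : L2Space d)) atTop (𝓝 (𝓕 (h2.toLp _))) :=
    ((Lp.fourierTransformₗᵢ (RSpace d) ℂ).continuous.tendsto _).comp hLp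
  obtain ⟨ψ, hψ, hlim⟩ := (tendstoInMeasure_of_tendsto_Lp hF).exists_seq_tendsto_ae
  refine ⟨ψ, hψ, ?_⟩
  have hall : ∀ᵐ ξ, ∀ k, (𝓕 ((hv2 k).toLp _) : L2Space d) ξ = 𝓕 (gaussianSlice (ε k) Φ y) ξ :=
    ae_all_iff.2 fun k => fourier_toLp_ae_eq (hvi k) (hv2 k)
  filter_upwards [hlim, hall] with ξ h1 h3
  exact h1.congr fun k => h3 (ψ k)

/-- The Fourier transforms of two square integrable slices of an entire function differ by the
exponential factor `e^{2π (y - y')·ξ}`. -/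
theorem exp_mul_fourier_slice_ae_eq {Φ : CSpace d → ℂ} (hΦ : Differentiable ℂ Φ) {M : ℝ → ℝ}
    (hM : Monotone M) (hb : ∀ x y, ‖Φ (complexPoint x y)‖ ≤ M ‖y‖) {y y' : RSpace d}
    (h2 : MemLp (fun x => Φ (complexPoint x y)) 2)
    (h2' : MemLp (fun x => Φ (complexPoint x y')) 2) :
    ∀ᵐ ξ, exp ((2 * Real.pi * ⟪y, ξ⟫ : ℝ) : ℂ) * (𝓕 (h2.toLp _) : L2Space d) ξ =
      exp ((2 * Real.pi * ⟪y', ξ⟫ : ℝ) : ℂ) * (𝓕 (h2'.toLp _) : L2Space d) ξ := by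
  set ε : ℕ → ℝ := fun k => 1 / ((k : ℝ) + 1) with hεdef
  have hε0 : ∀ k, 0 < ε k := fun k => by positivity
  have hε1 : ∀ k, ε k ≤ 1 := fun k => by
    simp only [hεdef]
    rw [div_le_one (by positivity)]
    linarith [Nat.cast_nonneg (α := ℝ) k]
  have hε : Tendsto ε atTop (𝓝 0) := tendsto_one_div_add_atTop_nhds_zero_nat
  obtain ⟨ψ, hψ, hlim⟩ := exists_tendsto_fourier_gaussianSlice hΦ.continuous
    (fun x => hb x y) h2 hε0 hε1 hε
  obtain ⟨χ, hχ, hlim'⟩ := exists_tendsto_fourier_gaussianSlice hΦ.continuous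
    (fun x => hb x y') h2' (ε := ε ∘ ψ) (fun k => hε0 _) (fun k => hε1 _)
    (hε.comp hψ.tendsto_atTop)
  filter_upwards [hlim, hlim'] with ξ h1 h3
  have h4 := (h1.comp hχ.tendsto_atTop).const_mul (exp ((2 * Real.pi * ⟪y, ξ⟫ : ℝ) : ℂ))
  have h5 := h3.const_mul (exp ((2 * Real.pi * ⟪y', ξ⟫ : ℝ) : ℂ))
  refine tendsto_nhds_unique h4 (h5.congr fun k => ?_)
  exact (exp_mul_fourier_gaussianSlice hΦ hM hb (hε0 _) y y' ξ).symm

/-- Every weighted square integrable entire function is the heat transform of a spectrum in the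
weighted `L²` space. The spectrum is read off from one square integrable slice; all the others have
the expected Fourier transform, so Plancherel's formula on each slice yields the weighted norm. -/
theorem exists_eq_heatTransform {t : ℝ} (ht : 0 < t) {n : ℕ} {Φ : CSpace d → ℂ}
    (hΦ : Differentiable ℂ Φ) (hint : WeightedSquareIntegrable t n Φ) :
    ∃ G : RSpace d → ℂ, MemLp G 2 ∧
      ∫⁻ ξ, ‖G ξ‖ₑ ^ 2 * ENNReal.ofReal (1 + ‖ξ‖ ^ (2 * n)) < ⊤ ∧ Φ = heatTransform t G := by
  obtain ⟨C, hC, hCb⟩ := hint.norm_sq_le ht hΦ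
  -- A bound of the form required by the contour shift, monotone on all of `ℝ`.
  set M : ℝ → ℝ := fun r => Real.sqrt (C * Real.exp ((max r 0 + 1) ^ 2 / t))
  have hM : Monotone M := by
    intro a b hab
    have : max a 0 ≤ max b 0 := max_le_max_right 0 hab
    have h0 : 0 ≤ max a 0 := le_max_right _ _
    simp only [M]
    gcongr
  have hb : ∀ x y, ‖Φ (complexPoint x y)‖ ≤ M ‖y‖ := by
    intro x y
    refine Real.le_sqrt_of_sq_le ?_
    rw [max_eq_left (norm_nonneg y)]
    exact hCb x y
  have hiter := (weightedSquareIntegrable_iff hΦ.continuous).1 hint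
  have hmeas : Measurable fun y : RSpace d => ∫⁻ x, ‖Φ (complexPoint x y)‖ₑ ^ 2 := by
    have h : Continuous fun p : RSpace d × RSpace d => Φ (complexPoint p.1 p.2) :=
      hΦ.continuous.comp (continuous_complexPoint (d := d))
    exact (h.measurable.enorm.pow_const 2).lintegral_prod_left'
  have hgood : ∀ᵐ y : RSpace d, MemLp (fun x => Φ (complexPoint x y)) 2 := by
    have h := ae_lt_top (((continuous_imWeight t n).measurable.ennreal_ofReal).mul hmeas) hiter.ne
    filter_upwards [h] with y hy
    rw [memLp_two_iff_lintegral (continuous_slice hΦ.continuous y).aestronglyMeasurable]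
    refine lt_top_iff_ne_top.2 fun htop => hy.ne ?_
    simp only [Pi.mul_apply, htop]
    exact ENNReal.mul_top (by simpa using imWeight_pos t n y)
  obtain ⟨y₀, h₀⟩ := hgood.exists
  set U : L2Space d := 𝓕 (h₀.toLp _)
  set G : RSpace d → ℂ := fun ξ =>
    ((Real.exp (2 * Real.pi ^ 2 * t * ‖ξ‖ ^ 2 + 2 * Real.pi * ⟪y₀, ξ⟫) : ℝ) : ℂ) * U ξ with hG
  have hGm : AEStronglyMeasurable G volume :=
    (by fun_prop : Continuous fun ξ : RSpace d => ((Real.exp (2 * Real.pi ^ 2 * t * ‖ξ‖ ^ 2 +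
      2 * Real.pi * ⟪y₀, ξ⟫) : ℝ) : ℂ)).aestronglyMeasurable.mul (Lp.memLp U).1
  have hdens : ∀ (y : RSpace d) (h2 : MemLp (fun x => Φ (complexPoint x y)) 2),
      sliceDensity t G y =ᵐ[volume] (𝓕 (h2.toLp _) : L2Space d) := by
    intro y h2
    filter_upwards [exp_mul_fourier_slice_ae_eq hΦ hM hb h2 h₀] with ξ hξ
    have h1 : sliceDensity t G y ξ = exp (-((2 * Real.pi * ⟪y, ξ⟫ : ℝ) : ℂ)) *
        (exp ((2 * Real.pi * ⟪y₀, ξ⟫ : ℝ) : ℂ) * U ξ) := by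
      simp only [sliceDensity, hG, ofReal_exp, ← mul_assoc, ← exp_add]
      congr 2
      push_cast
      ring
    rw [h1, ← hξ, ← mul_assoc, ← exp_add, neg_add_cancel, exp_zero, one_mul]
  have hGn : ∫⁻ ξ, ‖G ξ‖ₑ ^ 2 * ENNReal.ofReal (1 + ‖ξ‖ ^ (2 * n)) < ⊤ := by
    rw [← lintegral_imWeight_lt_top_iff ht n hGm]
    refine lt_of_eq_of_lt (lintegral_congr_ae ?_) hiter
    filter_upwards [hgood] with y h2
    have h3 : ∫⁻ ξ, ‖sliceDensity t G y ξ‖ₑ ^ 2 =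
        ∫⁻ ξ, ‖(𝓕 (h2.toLp _) : L2Space d) ξ‖ₑ ^ 2 :=
      lintegral_congr_ae ((hdens y h2).mono fun ξ hξ => by simp only [hξ])
    have h4 : ∫⁻ x, ‖h2.toLp _ x‖ₑ ^ 2 = ∫⁻ x, ‖Φ (complexPoint x y)‖ₑ ^ 2 :=
      lintegral_congr_ae (h2.coeFn_toLp.mono fun x hx => by simp only [hx])
    rw [h3, lintegral_enorm_sq_fourier, h4]
  have hG2 : MemLp G 2 := by
    rw [memLp_two_iff_lintegral hGm]
    refine lt_of_le_of_lt (lintegral_mono fun ξ => ?_) hGn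
    refine le_mul_of_one_le_right zero_le (ENNReal.one_le_ofReal.2 ?_)
    linarith [pow_nonneg (norm_nonneg ξ) (2 * n)]
  refine ⟨G, hG2, hGn, ?_⟩
  have hΨ := differentiable_heatTransform ht hG2
  refine eq_of_eqOn_real_translate hΦ hΨ y₀ (congrFun ?_)
  refine Continuous.ae_eq_iff_eq (volume : Measure (RSpace d))
    (continuous_slice hΦ.continuous y₀) (continuous_slice hΨ.continuous y₀) |>.1 ?_
  have hs := integrable_and_memLp_sliceDensity ht hG2 y₀
  have hLp : hs.2.toLp _ = (𝓕 (h₀.toLp _) : L2Space d) := by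
    refine Lp.ext ?_
    exact hs.2.coeFn_toLp.trans (hdens y₀ h₀)
  have hinv := fourierInv_toLp_ae_eq hs.1 hs.2
  rw [hLp, fourierInv_fourier_eq] at hinv
  filter_upwards [hinv, h₀.coeFn_toLp] with x hx hx0
  rw [heatTransform_complexPoint, ← hx, hx0]

lemma heatTransform_congr_ae {t : ℝ} {G G' : RSpace d → ℂ} (h : G =ᵐ[volume] G') :
    heatTransform t G = heatTransform t G' := by
  funext z
  refine integral_congr_ae ?_
  filter_upwards [h] with ξ hξ
  rw [hξ]

/-- The heat transform of the Fourier transform continues the image of the heat operator. -/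
lemma isAnalyticContinuation_heatTransform {t : ℝ} (ht : 0 < t) (f : L2Space d) :
    IsAnalyticContinuation (heatOperator t f) (heatTransform t (𝓕 f : L2Space d)) :=
  ⟨differentiable_heatTransform ht (Lp.memLp _),
    fun x => (heatOperator_eq_heatTransform ht f x).symm⟩

end HeatImage

theorem theorem2p4 (d : ℕ) (t : ℝ) (ht : 0 < t) (n : ℕ) (hn : 0 < n)
    (F : HeatImage.RSpace d → ℂ) :
    (HeatImage.IsHeatImageOfSobolev t n F ↔
      ∃ Φ : HeatImage.CSpace d → ℂ,
        HeatImage.IsAnalyticContinuation F Φ ∧ HeatImage.WeightedSquareIntegrable t n Φ) ∧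
    (HeatImage.IsHeatImageOfSobolev t n F →
      ∀ Φ : HeatImage.CSpace d → ℂ, HeatImage.IsAnalyticContinuation F Φ →
        ∃ C : ℝ, ∀ x y : HeatImage.RSpace d,
          ‖Φ (HeatImage.complexPoint x y)‖ ≤
            C * (Real.exp (‖y‖ ^ 2 / (2 * t)) / (1 + ‖y‖ ^ n))) := by
  open HeatImage FourierTransform in
  refine ⟨⟨?_, ?_⟩, ?_⟩
  · rintro ⟨f, hf, rfl⟩
    exact ⟨_, isAnalyticContinuation_heatTransform ht f,
      weightedSquareIntegrable_heatTransform ht (Lp.memLp _)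
        ((memSobolev_iff_lintegral hn f).1 hf)⟩
  · rintro ⟨Φ, ⟨hΦ, hΦF⟩, hint⟩
    obtain ⟨G, hG, hGn, rfl⟩ := exists_eq_heatTransform ht hΦ hint
    have hae : ((𝓕 (𝓕⁻ (hG.toLp G)) : L2Space d) : RSpace d → ℂ) =ᵐ[volume] G := by
      rw [fourier_fourierInv_eq]
      exact hG.coeFn_toLp
    refine ⟨𝓕⁻ (hG.toLp G), (memSobolev_iff_lintegral hn _).2 ?_, ?_⟩
    · refine lt_of_eq_of_lt (lintegral_congr_ae ?_) hGn
      filter_upwards [hae] with ξ hξ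
      rw [hξ]
    · funext x
      rw [heatOperator_eq_heatTransform ht, heatTransform_congr_ae hae, hΦF]
  · rintro ⟨f, hf, rfl⟩ Φ ⟨hΦ, hΦF⟩
    obtain ⟨hΨ, hΨF⟩ := isAnalyticContinuation_heatTransform ht f
    rw [eq_of_eqOn_real_translate hΦ hΨ 0 fun x => by rw [hΦF, hΨF]]
    exact exists_norm_heatTransform_le ht ((memSobolev_iff_lintegral hn f).1 hf)
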